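/- **Definitions.** Let $T$ be a finite ordered rooted tree with edge labels (characters) from an arbitrary alphabet. For a node $v$ with children $v_1,\dots,v_k$ in left-to-right order, $T(v)$ is the set consisting of $v$ and its proper descendants and $F(v)$ is the set of proper descendants of $v$. For $1\le s\le r\le k$, a cluster with top boundary node $v$ is a connected part of $T$ of the form $T(v,v_s,v_r)=\{v\}\cup T(v_s)\cup\dots\cup T(v_r)$ (no bottom boundary node) or $T(v,v_s,v_r)\setminus F(u)$ with $u\in T(v_s)\cup\dots\cup T(v_r)$ (bottom boundary node $u$). The single edge from a node $w$ to its parent is a cluster, with bottom boundary node $w$ unless $w$ is a leaf of $T$. Two clusters $A$ (left) and $B$ (right) whose vertex sets meet in exactly one node, a boundary node $x$ of both, can be merged if their union $C$ is a cluster. A merge is *vertical* if $x$ is the bottom boundary node of $A$ and the top boundary node of $B$; it is of type (a) if $B$ has a bottom boundary node (then it is that of $C$), and of type (b) if not (then $C$ has none). A merge is *horizontal* if $x$ is the top boundary node of $A$, $B$ and $C$, the children of $x$ in $A$ precede those in $B$, and at most one of $A,B$ has a bottom boundary node (which $C$ inherits); it is of type (c), (d) or (e) according to whether $A$, $B$ or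 neither has one. A *top tree* $\mathcal T$ of $T$ is an ordered binary tree whose nodes are clusters: its leaves are single edges, labelled by the character of the edge, each internal node is the merge of its left and right child and is labelled by the type (a)–(e) of the merge, and its root is $T$ itself, with the root of $T$ as top boundary node and no bottom boundary node. The *top DAG* $\mathcal{TD}$ is obtained from $\mathcal T$ by identifying nodes that root identical labelled subtrees. The *spine path* of a cluster $C$ is the path from its top to its bottom boundary node; if $C$ is a type (b) merge of $A$ and $B$, its spine path is that of $A$. The string of labels on it, from top to bottom, is $\mathrm{spine}(C)$. The *vertical top forest* $\mathcal V$ has as nodes the vertical clusters of $\mathcal T$ and the leaf clusters of $\mathcal T$ whose edge lies on the spine path of some cluster in $\mathcal T$. A vertical cluster $C$ with children $A,B$ in $\mathcal T$ has as left (for type (b): only) child in $\mathcal V$ the unique vertical or leaf proper descendant of $C$ in $\mathcal T$ whose spine path is that of $A$, and, for type (a), as right child the unique one whose spine path is that of $B$. The *vertical top DAG* $\mathcal{VD}$ is obtained from $\mathcal V$ by identifying the nodes that are identified in $\mathcal{TD}$; $n_{\mathcal{VD}}$ is its number of nodes. **Model.** In a pointer machine a data structure is a finite directed graph, each node of which has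 a fixed number of pointer fields and a field for one character. A query algorithm is a fixed finite program with a fixed number of pointer registers; in one step it copies a register, follows a pointer, overwrites a pointer field, creates a node, jumps if a register is null or if two registers are equal, reports the character stored in a node, or halts. Space is the number of nodes of the data structure. **Lemma.** There are a pointer machine program and a constant $c$ (both independent of alphabet, tree and top tree) such that for every finite ordered edge-labelled tree $T$ and every top tree $\mathcal T$ of $T$ there is a data structure with at most $c\cdot n_{\mathcal{VD}}$ nodes that contains $\mathcal{VD}$ (each node of $\mathcal{VD}$ has its own memory node, with fixed pointer fields leading to its left and right child, null where there is no such child, and, for a leaf, the character of its edge) and supports spine path extraction in time $O(\ell)$: for every vertical cluster $C$ of $\mathcal T$, the program, started with a pointer to the memory node of $C$, reports the characters of $\mathrm{spine}(C)$ online from top to bottom. That is, at all times a prefix of $\mathrm{spine}(C)$ has been reported, for every $\ell\le|\mathrm{spine}(C)|$ the first $\ell$ characters have been reported after $c\,\ell$ steps, and after $c\,|\mathrm{spine}(C)|$ steps the program has halted with exactly $\mathrm{spine}(C)$ reported. The nodes of the data structure are unmodified throughout. -/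

import Mathlib

/-! ## Ordered rooted trees with labelled edges -/

/-- A finite ordered rooted tree whose edges carry labels in `α`. A node is the list of child
indices on the path from the root to it, so the root is `[]` and the children of `v`, from left to
right, are `v ++ [0]`, `v ++ [1]`, and so on. An edge is named by its lower endpoint `v`, and
`label v` is the label of the edge between `v` and its parent (used only for nodes `v ≠ []`). -/
structure LabeledTree (α : Type*) where
  nodes : Finset (List ℕ)
  root_mem : [] ∈ nodes
  parent_mem : ∀ (v : List ℕ) (i : ℕ), v ++ [i] ∈ nodes → v ∈ nodes
  sibling_mem : ∀ (v : List ℕ) (i : ℕ), v ++ [i + 1] ∈ nodes → v ++ [i] ∈ nodes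
  label : List ℕ → α

/-- The node `v` has no children. -/
def LabeledTree.IsLeaf {α : Type*} (T : LabeledTree α) (v : List ℕ) : Prop :=
  ∀ j, v ++ [j] ∉ T.nodes

/-! ## Clusters and merges -/

/-- The data of a cluster: top boundary node, first and last child of the top boundary node that
belong to it, and the bottom boundary node if there is one. -/
structure Cluster where
  top : List ℕ
  lo : ℕ
  hi : ℕ
  bot : Option (List ℕ)

namespace Cluster

/-- The nodes of `T(v, v_s, v_r)`, or of `T(v, v_s, v_r) \ F(u)` if `u` is the bottom boundary node,
where `F(u)` is the set of proper descendants of `u`. -/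
def verts {α : Type*} (T : LabeledTree α) (C : Cluster) : Set (List ℕ) :=
  {w | w ∈ T.nodes ∧ (w = C.top ∨ ∃ i, C.lo ≤ i ∧ i ≤ C.hi ∧ (C.top ++ [i]) <+: w) ∧
    ¬ ∃ u, C.bot = some u ∧ u <+: w ∧ u ≠ w}

/-- `C` is a cluster of `T`: the first and the last child exist and are in order, and a bottom
boundary node is a node in the subtrees of the chosen children. -/
def IsCluster {α : Type*} (T : LabeledTree α) (C : Cluster) : Prop :=
  C.lo ≤ C.hi ∧ C.top ++ [C.hi] ∈ T.nodes ∧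
    ∀ u, C.bot = some u → u ∈ T.nodes ∧ ∃ i, C.lo ≤ i ∧ i ≤ C.hi ∧ (C.top ++ [i]) <+: u

open Classical in
/-- The cluster that consists of the single edge between `p` and its child `p ++ [i]`. -/
noncomputable def edge {α : Type*} (T : LabeledTree α) (p : List ℕ) (i : ℕ) : Cluster where
  top := p
  lo := i
  hi := i
  bot := if T.IsLeaf (p ++ [i]) then none else some (p ++ [i])

end Cluster

/-- The five ways of merging two clusters: `a` and `b` are vertical, `c`, `d`, `e` horizontal. -/
inductive MergeType
  | a | b | c | d | e

/-- A merge of type `a` or `b`. -/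
def MergeType.IsVertical : MergeType → Prop
  | .a => True
  | .b => True
  | _ => False

/-- Which boundary nodes `A`, `B` and `C` have when the clusters `A` (left) and `B` (right), which
share the node `x`, are merged to `C`. In a horizontal merge the children of `x` in `A` precede
those in `B`; thus in every merge `A` is visited before `B` in a preorder traversal. -/
def MergeType.Boundary (x : List ℕ) (A B C : Cluster) : MergeType → Prop
  | .a => A.bot = some x ∧ B.top = x ∧ B.bot ≠ none ∧ C.top = A.top ∧ C.bot = B.bot
  | .b => A.bot = some x ∧ B.top = x ∧ B.bot = none ∧ C.top = A.top ∧ C.bot = none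
  | .c => A.top = x ∧ B.top = x ∧ C.top = x ∧ A.hi < B.lo ∧
      A.bot ≠ none ∧ B.bot = none ∧ C.bot = A.bot
  | .d => A.top = x ∧ B.top = x ∧ C.top = x ∧ A.hi < B.lo ∧
      A.bot = none ∧ B.bot ≠ none ∧ C.bot = B.bot
  | .e => A.top = x ∧ B.top = x ∧ C.top = x ∧ A.hi < B.lo ∧
      A.bot = none ∧ B.bot = none ∧ C.bot = none

/-- The clusters `A` and `B` overlap in a single node, which is a boundary node of both, and their
union is the cluster `C`. (For a vertical merge this forces `B` to contain all children of the
common boundary node, so that it is a boundary node of no further cluster.) -/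
def IsMerge {α : Type*} (T : LabeledTree α) (ty : MergeType) (A B C : Cluster) : Prop :=
  A.IsCluster T ∧ B.IsCluster T ∧ C.IsCluster T ∧ C.verts T = A.verts T ∪ B.verts T ∧
    ∃ x, A.verts T ∩ B.verts T = {x} ∧ ty.Boundary x A B C

/-! ## Top trees -/

/-- Binary trees whose leaves are edges (`leaf p i` is the edge between `p` and `p ++ [i]`) and whose
internal nodes carry a merge type and the merged cluster. -/
inductive TopTree
  | leaf (p : List ℕ) (i : ℕ)
  | node (ty : MergeType) (C : Cluster) (l r : TopTree)

/-- Binary trees with internal nodes labelled by merge types and leaves labelled by characters. -/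
inductive LabelTree (α : Type*)
  | leaf (x : α)
  | node (ty : MergeType) (l r : LabelTree α)

namespace TopTree

/-- The cluster of the root of a top tree. -/
noncomputable def cluster {α : Type*} (T : LabeledTree α) : TopTree → Cluster
  | leaf p i => Cluster.edge T p i
  | node _ C _ _ => C

/-- Leaves are edges of `T`, and the cluster of an internal node is the merge of the clusters of its
children. -/
def Valid {α : Type*} (T : LabeledTree α) : TopTree → Prop
  | leaf p i => p ++ [i] ∈ T.nodes
  | node ty C l r =>
      l.Valid T ∧ r.Valid T ∧ IsMerge T ty (l.cluster T) (r.cluster T) C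

/-- `τ` is a top tree of `T`: its root is the cluster `T` itself, with top boundary node the root. -/
def IsTopTreeOf {α : Type*} (τ : TopTree) (T : LabeledTree α) : Prop :=
  τ.Valid T ∧ (τ.cluster T).top = [] ∧ (τ.cluster T).bot = none ∧
    (τ.cluster T).verts T = (T.nodes : Set (List ℕ))

/-- The nodes of a top tree, each given by the subtree rooted at it. -/
def subtrees : TopTree → Set TopTree
  | leaf p i => {leaf p i}
  | node ty C l r => insert (node ty C l r) (l.subtrees ∪ r.subtrees)

/-- The cluster is a leaf cluster. -/
def IsLeafCluster : TopTree → Prop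
  | leaf _ _ => True
  | node _ _ _ _ => False

/-- The cluster is a vertical cluster. -/
def IsVertical : TopTree → Prop
  | leaf _ _ => False
  | node ty _ _ _ => ty.IsVertical

/-- The labelled tree that underlies a top tree: a leaf is labelled by the label of its edge, an
internal node by its merge type. Two nodes of a top tree are merged in the top DAG if and only if
these labelled trees coincide. -/
def erase {α : Type*} (T : LabeledTree α) : TopTree → LabelTree α
  | leaf p i => .leaf (T.label (p ++ [i]))
  | node ty _ l r => .node ty (l.erase T) (r.erase T)

/-- The lower end of the spine: the bottom boundary node of the cluster, and for a merge of type `b`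
(which has no bottom boundary node) that of its left child. -/
noncomputable def spineEnd {α : Type*} (T : LabeledTree α) : TopTree → Option (List ℕ)
  | leaf p i => (Cluster.edge T p i).bot
  | node .b _ l _ => (l.cluster T).bot
  | node _ C _ _ => C.bot

/-- The spine path as the list of its edges from top to bottom; empty if there is no spine. The
edges are named by their lower endpoints: the prefixes of the lower end `u` that are longer than the
top boundary node. -/
noncomputable def spinePath {α : Type*} (T : LabeledTree α) (C : TopTree) : List (List ℕ) :=
  match C.spineEnd T with
  | none => []
  | some u => u.inits.drop ((C.cluster T).top.length + 1)

/-- The string of the labels on the spine path from top to bottom. -/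
noncomputable def spine {α : Type*} (T : LabeledTree α) (C : TopTree) : List α :=
  (C.spinePath T).map T.label

/-! ## The vertical top forest and the vertical top DAG -/

/-- The nodes of the vertical top forest: the vertical clusters, and the leaf clusters whose edge is
on the spine path of some cluster. -/
def forestNodes {α : Type*} (T : LabeledTree α) (τ : TopTree) : Set TopTree :=
  {D | D ∈ τ.subtrees ∧ (D.IsVertical ∨
    ∃ p i, D = leaf p i ∧ ∃ E ∈ τ.subtrees, p ++ [i] ∈ E.spinePath T)}

/-- `D` is the left (for `b`: the only) child of the vertical cluster `C` in the vertical top forest: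
the vertical or leaf proper descendant of `C` whose spine path is that of the left child of `C`. -/
def ForestLeft {α : Type*} (T : LabeledTree α) (C D : TopTree) : Prop :=
  ∃ ty K A B, C = node ty K A B ∧ ty.IsVertical ∧ D ∈ A.subtrees ∪ B.subtrees ∧
    (D.IsVertical ∨ D.IsLeafCluster) ∧ D.spinePath T = A.spinePath T

/-- `D` is the right child of the cluster `C` of type `a` in the vertical top forest: the vertical or
leaf proper descendant of `C` whose spine path is that of the right child of `C`. -/
def ForestRight {α : Type*} (T : LabeledTree α) (C D : TopTree) : Prop :=
  ∃ K A B, C = node .a K A B ∧ D ∈ A.subtrees ∪ B.subtrees ∧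
    (D.IsVertical ∨ D.IsLeafCluster) ∧ D.spinePath T = B.spinePath T

/-- The nodes of the vertical top DAG: nodes of the vertical top forest, merged if they are merged
in the top DAG. -/
def dagNodes {α : Type*} (T : LabeledTree α) (τ : TopTree) : Set (LabelTree α) :=
  (fun D => D.erase T) '' τ.forestNodes T

/-- Edges to left children in the vertical top DAG. -/
def DagLeft {α : Type*} (T : LabeledTree α) (τ : TopTree) (X Y : LabelTree α) : Prop :=
  ∃ C ∈ τ.forestNodes T, ∃ D ∈ τ.forestNodes T,
    ForestLeft T C D ∧ C.erase T = X ∧ D.erase T = Y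

/-- Edges to right children in the vertical top DAG. -/
def DagRight {α : Type*} (T : LabeledTree α) (τ : TopTree) (X Y : LabelTree α) : Prop :=
  ∃ C ∈ τ.forestNodes T, ∃ D ∈ τ.forestNodes T,
    ForestRight T C D ∧ C.erase T = X ∧ D.erase T = Y

/-- The size of the vertical top DAG. -/
noncomputable def dagSize {α : Type*} (T : LabeledTree α) (τ : TopTree) : ℕ :=
  (τ.dagNodes T).ncard

theorem subtrees_finite (τ : TopTree) : τ.subtrees.Finite := by
  induction τ with
  | leaf p i => exact Set.finite_singleton _
  | node ty C l r hl hr => exact (hl.union hr).insert _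

theorem dagNodes_finite {α : Type*} (T : LabeledTree α) (τ : TopTree) :
    (τ.dagNodes T).Finite :=
  (τ.subtrees_finite.subset fun _ h => h.1).image _

end TopTree

/-! ## Pointer machines -/

/-- A memory node with `k` pointer fields and one data field for a character. -/
structure Cell (k : ℕ) (α : Type*) where
  ptr : Fin k → Option ℕ
  data : Option α

/-- The instructions of a pointer machine with `k` pointer fields per node and the pointer registers
`0, …, r`. There is no arithmetic, neither on addresses nor on characters. -/
inductive Instr (k r : ℕ)
  /-- copy register `s` to register `d` -/
  | move (d s : Fin (r + 1))
  /-- follow pointer field `i` of the node in register `s` -/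
  | load (d s : Fin (r + 1)) (i : Fin k)
  /-- overwrite pointer field `i` of the node in register `s` by register `v` -/
  | store (s : Fin (r + 1)) (i : Fin k) (v : Fin (r + 1))
  /-- create a new node, with pointer fields copied from the given registers -/
  | alloc (d : Fin (r + 1)) (src : Fin k → Fin (r + 1))
  /-- jump if the register is null -/
  | jumpNull (s : Fin (r + 1)) (target : ℕ)
  /-- jump if the two registers are equal -/
  | jumpEq (s s' : Fin (r + 1)) (target : ℕ)
  /-- report the character stored in the node in register `s` -/
  | output (s : Fin (r + 1))
  | halt

/-- A pointer machine program: a fixed out-degree, a fixed number of registers, a finite code. -/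
structure PointerProgram where
  fields : ℕ
  regs : ℕ
  code : List (Instr fields regs)

namespace PointerProgram

/-- A configuration. The nodes in memory are numbered; new nodes are appended. -/
structure Config (P : PointerProgram) (α : Type*) where
  pc : ℕ
  reg : Fin (P.regs + 1) → Option ℕ
  heap : List (Cell P.fields α)
  out : List α

/-- One step. After `halt`, and at a faulty access, the configuration does not change any more. -/
def step {α : Type*} (P : PointerProgram) (s : Config P α) : Config P α :=
  match P.code[s.pc]? with
  | none => s
  | some .halt => s
  | some (.move d x) => { s with pc := s.pc + 1, reg := Function.update s.reg d (s.reg x) }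
  | some (.load d x i) =>
      match (s.reg x).bind (fun a => s.heap[a]?) with
      | none => s
      | some cell => { s with pc := s.pc + 1, reg := Function.update s.reg d (cell.ptr i) }
  | some (.store x i v) =>
      match s.reg x with
      | none => s
      | some a =>
          match s.heap[a]? with
          | none => s
          | some cell =>
              { s with
                pc := s.pc + 1
                heap := s.heap.set a
                  { cell with ptr := Function.update cell.ptr i (s.reg v) } }
  | some (.alloc d src) =>
      { s with
        pc := s.pc + 1
        reg := Function.update s.reg d (some s.heap.length)
        heap := s.heap ++ [{ ptr := fun i => s.reg (src i), data := none }] }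
  | some (.jumpNull x t) => { s with pc := if s.reg x = none then t else s.pc + 1 }
  | some (.jumpEq x y t) => { s with pc := if s.reg x = s.reg y then t else s.pc + 1 }
  | some (.output x) =>
      match (s.reg x).bind (fun a => s.heap[a]?) with
      | none => s
      | some cell =>
          match cell.data with
          | none => s
          | some ch => { s with pc := s.pc + 1, out := s.out ++ [ch] }

/-- The start of a query on the data structure `H`: register `0` holds the given pointer into `H`,
all other registers are null, nothing has been reported. -/
def init {α : Type*} (P : PointerProgram) (H : List (Cell P.fields α)) (entry : ℕ) :
    Config P α where
  pc := 0
  reg := fun j => if j = 0 then some entry else none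
  heap := H
  out := []

/-- The configuration after `t` steps of a query. -/
def run {α : Type*} (P : PointerProgram) (H : List (Cell P.fields α)) (entry t : ℕ) :
    Config P α :=
  P.step^[t] (P.init H entry)

/-- The query with pointer `entry` reports the string `s` online and from left to right with `c` steps
per character: at any time a prefix of `s` has been reported and the data structure `H` is intact
(new nodes may have been created), the first `ℓ` characters have been reported after `c * ℓ` steps,
and after `c * |s|` steps the machine has halted with exactly `s` reported. -/
def ExtractsOnline {α : Type*} (P : PointerProgram) (c : ℕ) (H : List (Cell P.fields α))
    (entry : ℕ) (s : List α) : Prop :=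
  (∀ t, H <+: (P.run H entry t).heap ∧ (P.run H entry t).out <+: s) ∧
  (∀ ℓ ≤ s.length, s.take ℓ <+: (P.run H entry (c * ℓ)).out) ∧
  (P.run H entry (c * s.length)).out = s ∧
  P.code[(P.run H entry (c * s.length)).pc]? = some .halt

/-- All pointers of `H` point to nodes of `H`. -/
def ClosedHeap {k : ℕ} {α : Type*} (H : List (Cell k α)) : Prop :=
  ∀ cell ∈ H, ∀ i a, cell.ptr i = some a → a < H.length

/-- `H` contains the vertical top DAG: every node `X` of the DAG has its own memory node `addr X`,
whose pointer fields `left` and `right` lead to the children of `X` (null where there is no child)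
and which stores the character of `X` if `X` is a leaf. -/
def ContainsDag {k : ℕ} {α : Type*} (H : List (Cell k α)) (left right : Fin k)
    (T : LabeledTree α) (τ : TopTree) (addr : LabelTree α → ℕ) : Prop :=
  Set.InjOn addr (τ.dagNodes T) ∧
  ∀ X ∈ τ.dagNodes T, ∃ cell, H[addr X]? = some cell ∧
    (∀ Y, τ.DagLeft T X Y → cell.ptr left = some (addr Y)) ∧
    ((¬ ∃ Y, τ.DagLeft T X Y) → cell.ptr left = none) ∧
    (∀ Y, τ.DagRight T X Y → cell.ptr right = some (addr Y)) ∧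
    ((¬ ∃ Y, τ.DagRight T X Y) → cell.ptr right = none) ∧
    (∀ x, X = .leaf x → cell.data = some x)

end PointerProgram

/-! The spines are the strings of a straight-line program that is no larger than the vertical top
DAG, and a straight-line program can be read with constant delay if every node stores a constant
number of well-chosen pointers.

Grammar. A merge of type (a) concatenates the spine paths of its children; types (b), (c), (d) copy
that of one child (`spinePath_typeA` to `spinePath_typeD`). Skipping horizontal merges (`core`)
gives the children in the vertical top forest: spine paths on the two sides of a merge share no
edge, so the child is unique (`eq_core`), and it depends on the labelled subtree only
(`erase_core`). Hence `LabelTree.toSL` yields straight-line programs for the spines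
(`spine_eq_str`), closed under children (`children_mem_toSL_image`). A cluster of type (b) has the
same program as its only child, so DAG nodes and programs get separate memory nodes, at most twice
the size of the DAG in all.

Reading. The string of `x` is its first character followed by the strings of the right children
along its leftmost path, from the bottom up; but pointers to left children lead down. So `x` points
to an anchor `u` on its leftmost path whose depth (length of the leftmost path) is a power of two `2
^ e` with `x.depth < 4 * 2 ^ e`. The leftmost path of `u`, from the bottom up, is a list of `2 ^ e`
elements, spread over the nodes of depth `2 ^ e, …, 2 ^ (e + 1) - 1` on one chosen leftmost path
through `u` (`carrier`). A node determines from its depth the only list that it can serve, so one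
item and one successor per node suffice. While this list is traversed, one element per reported
character, a second pointer descends from `x` by three left edges per element and stacks the right
children that it passes. It has reached `u` when the list ends (`advance`), so every round reports a
character in constant time (`loop`). -/

/-! ## Spines of clusters -/

namespace LabeledTree

theorem mem_of_prefix {α : Type*} (T : LabeledTree α) {v w : List ℕ} (h : v <+: w)
    (hw : w ∈ T.nodes) : v ∈ T.nodes := by
  obtain ⟨t, rfl⟩ := h
  induction t using List.reverseRecOn with
  | nil => simpa using hw
  | append_singleton t i ih =>
    exact ih (T.parent_mem _ i (by simpa [List.append_assoc] using hw))

end LabeledTree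

namespace Cluster

variable {α : Type*} {T : LabeledTree α} {C : Cluster}

theorem top_prefix_of_mem_verts {w : List ℕ} (h : w ∈ C.verts T) : C.top <+: w := by
  obtain ⟨-, rfl | ⟨i, -, -, h⟩, -⟩ := h
  · exact List.prefix_rfl
  · exact (List.prefix_append _ _).trans h

theorem IsCluster.length_top_lt (h : C.IsCluster T) {u : List ℕ} (hu : C.bot = some u) :
    C.top.length < u.length := by
  obtain ⟨-, i, -, -, hp⟩ := h.2.2 u hu
  simpa [Nat.succ_le_iff] using hp.length_le

theorem IsCluster.top_prefix_bot (h : C.IsCluster T) {u : List ℕ} (hu : C.bot = some u) :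
    C.top <+: u := by
  obtain ⟨-, i, -, -, hp⟩ := h.2.2 u hu
  exact (List.prefix_append _ _).trans hp

theorem IsCluster.top_mem_verts (h : C.IsCluster T) : C.top ∈ C.verts T := by
  refine ⟨T.parent_mem _ _ h.2.1, Or.inl rfl, ?_⟩
  rintro ⟨u, hu, hp, -⟩
  exact absurd hp.length_le (not_le.2 (h.length_top_lt hu))

/-- A node on the path between the boundary nodes of a cluster belongs to the cluster. -/
theorem IsCluster.mem_verts_of_prefix_bot (h : C.IsCluster T) {u e : List ℕ}
    (hu : C.bot = some u) (he : e <+: u) (hl : C.top.length < e.length) : e ∈ C.verts T := by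
  obtain ⟨hun, i, h1, h2, hp⟩ := h.2.2 u hu
  refine ⟨T.mem_of_prefix he hun, Or.inr ⟨i, h1, h2, ?_⟩, ?_⟩
  · exact List.prefix_of_prefix_length_le hp he (by simpa [Nat.succ_le_iff] using hl)
  · rintro ⟨u', hu', hp', hne⟩
    rw [hu, Option.some.injEq] at hu'
    subst hu'
    exact hne (hp'.eq_of_length (le_antisymm hp'.length_le he.length_le))

theorem isCluster_edge {p : List ℕ} {i : ℕ} (h : p ++ [i] ∈ T.nodes) :
    (edge T p i).IsCluster T := by
  refine ⟨le_rfl, h, fun u hu => ?_⟩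
  simp only [edge] at hu ⊢
  split_ifs at hu
  cases hu
  exact ⟨h, i, le_rfl, le_rfl, List.prefix_rfl⟩

end Cluster

/-! ### Paths as lists of initial segments. -/

theorem List.mem_drop_inits {u e : List ℕ} {n : ℕ} :
    e ∈ u.inits.drop n ↔ e <+: u ∧ n ≤ e.length := by
  induction n generalizing u e with
  | zero => simp
  | succ n ih =>
    cases u with
    | nil =>
      simp only [List.inits, List.drop_succ_cons, List.drop_nil, List.not_mem_nil, false_iff]
      rintro ⟨h, h'⟩
      simp [List.prefix_nil.1 h] at h'
    | cons a u =>
      simp only [List.inits_cons, List.drop_succ_cons, ← List.map_drop, List.mem_map, ih]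
      constructor
      · rintro ⟨e, ⟨h1, h2⟩, rfl⟩
        exact ⟨by simpa using h1, by simpa using h2⟩
      · rintro ⟨h1, h2⟩
        cases e with
        | nil => simp at h2
        | cons b e =>
          obtain ⟨rfl, h1'⟩ := List.cons_prefix_cons.1 h1
          exact ⟨e, ⟨h1', by simpa using h2⟩, rfl⟩

/-- Cuts a path at an intermediate node `x`; this splits the spine path of a type (a) merge at the
common boundary node. -/
theorem List.drop_inits_append {x t : List ℕ} {n : ℕ} (h : n ≤ x.length + 1) :
    (x ++ t).inits.drop n = x.inits.drop n ++ (x ++ t).inits.drop (x.length + 1) := by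
  induction x generalizing n with
  | nil => cases n with
    | zero => cases t <;> simp
    | succ n =>
      obtain rfl : n = 0 := by simpa using h
      simp
  | cons a x ih =>
    cases n with
    | zero =>
      have := ih (n := 0) (by omega)
      simp only [List.drop_zero] at this
      simp only [List.cons_append, List.inits_cons, List.drop_zero, List.length_cons,
        List.drop_succ_cons, ← List.map_drop]
      rw [← List.map_append, ← this]
    | succ n =>
      simp only [List.cons_append, List.inits_cons, List.length_cons, List.drop_succ_cons,
        ← List.map_drop]
      rw [ih (by simpa using h), List.map_append]

theorem List.drop_inits_concat (p : List ℕ) (i : ℕ) :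
    (p ++ [i]).inits.drop (p.length + 1) = [p ++ [i]] := by
  induction p with
  | nil => simp
  | cons a p ih => simp

theorem MergeType.Boundary.top_right {ty : MergeType} {x : List ℕ} {A B C : Cluster}
    (h : ty.Boundary x A B C) : B.top = x := by
  cases ty <;> simp only [MergeType.Boundary] at h <;> tauto

namespace TopTree

variable {α : Type*} {T : LabeledTree α}

theorem mem_subtrees_self (τ : TopTree) : τ ∈ τ.subtrees := by
  cases τ <;> simp [subtrees]

theorem subtrees_trans {D E τ : TopTree} (h : D ∈ E.subtrees) (h' : E ∈ τ.subtrees) :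
    D ∈ τ.subtrees := by
  induction τ with
  | leaf p i =>
    obtain rfl : E = leaf p i := h'
    exact h
  | node ty C l r hl hr =>
    rcases h' with rfl | h' | h'
    · exact h
    · exact Or.inr (Or.inl (hl h'))
    · exact Or.inr (Or.inr (hr h'))

theorem Valid.of_mem_subtrees {D τ : TopTree} (h : τ.Valid T) (hD : D ∈ τ.subtrees) :
    D.Valid T := by
  induction τ with
  | leaf p i =>
    obtain rfl : D = leaf p i := hD
    exact h
  | node ty C l r hl hr =>
    rcases hD with rfl | hD | hD
    · exact h
    · exact hl h.1 hD
    · exact hr h.2.1 hD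

theorem Valid.isCluster {τ : TopTree} (h : τ.Valid T) : (τ.cluster T).IsCluster T := by
  cases τ with
  | leaf p i => exact Cluster.isCluster_edge h
  | node ty C l r => exact h.2.2.2.2.1

theorem Valid.verts_subset {D τ : TopTree} (h : τ.Valid T) (hD : D ∈ τ.subtrees) :
    (D.cluster T).verts T ⊆ (τ.cluster T).verts T := by
  induction τ with
  | leaf p i =>
    obtain rfl : D = leaf p i := hD
    exact subset_rfl
  | node ty C l r hl hr =>
    have hC : C.verts T = _ := h.2.2.2.2.2.1
    rcases hD with rfl | hD | hD
    · exact subset_rfl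
    · exact (hl h.1 hD).trans (by simp only [cluster]; rw [hC]; exact Set.subset_union_left)
    · exact (hr h.2.1 hD).trans (by simp only [cluster]; rw [hC]; exact Set.subset_union_right)

/-! ### Spine paths under the merge types. -/

theorem cluster_node (ty : MergeType) (C : Cluster) (l r : TopTree) :
    (node ty C l r).cluster T = C := rfl

theorem left_mem_subtrees (ty : MergeType) (C : Cluster) (l r : TopTree) :
    l ∈ (node ty C l r).subtrees :=
  Or.inr (Or.inl l.mem_subtrees_self)

theorem right_mem_subtrees (ty : MergeType) (C : Cluster) (l r : TopTree) :
    r ∈ (node ty C l r).subtrees :=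
  Or.inr (Or.inr r.mem_subtrees_self)

/-- Only for type (b) do the two definitions differ, and a cluster of type (b) has no bottom
boundary node. -/
theorem spineEnd_eq_bot {D : TopTree} (h : D.Valid T) (hb : (D.cluster T).bot ≠ none) :
    D.spineEnd T = (D.cluster T).bot := by
  cases D with
  | leaf p i => rfl
  | node ty C l r =>
    cases ty <;> try rfl
    obtain ⟨-, -, -, -, -, -, x, -, hx⟩ := h
    exact absurd hx.2.2.2.2 hb

theorem spinePath_of_bot {D : TopTree} (h : D.Valid T) {u : List ℕ}
    (hb : (D.cluster T).bot = some u) :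
    D.spinePath T = u.inits.drop ((D.cluster T).top.length + 1) := by
  have := spineEnd_eq_bot h (by simp [hb])
  simp only [spinePath, this, hb]

theorem spinePath_ne_nil {D : TopTree} (h : D.Valid T) (hb : (D.cluster T).bot ≠ none) :
    D.spinePath T ≠ [] := by
  obtain ⟨u, hu⟩ := Option.ne_none_iff_exists'.1 hb
  rw [spinePath_of_bot h hu]
  exact List.ne_nil_of_mem
    (List.mem_drop_inits.2 ⟨List.prefix_rfl, h.isCluster.length_top_lt hu⟩)

theorem spinePath_typeB {K : Cluster} {A B : TopTree} (h : (node .b K A B).Valid T) :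
    (node .b K A B).spinePath T = A.spinePath T := by
  obtain ⟨hA, -, -, -, -, -, x, -, hx⟩ := h
  rw [spinePath_of_bot hA hx.1]
  simp only [spinePath, spineEnd, hx.1, cluster_node, hx.2.2.2.1]

theorem spinePath_typeA {K : Cluster} {A B : TopTree} (h : (node .a K A B).Valid T) :
    (node .a K A B).spinePath T = A.spinePath T ++ B.spinePath T := by
  obtain ⟨hA, hB, -, -, -, -, x, -, h1, rfl, h3, h4, h5⟩ := id h
  obtain ⟨u, hu⟩ := Option.ne_none_iff_exists'.1 h3
  rw [spinePath_of_bot hA h1, spinePath_of_bot hB hu, spinePath_of_bot h (u := u) (h5.trans hu)]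
  obtain ⟨t, rfl⟩ := hB.isCluster.top_prefix_bot hu
  simp only [cluster_node, h4]
  exact List.drop_inits_append (by have := hA.isCluster.length_top_lt h1; omega)

theorem spinePath_typeC {K : Cluster} {A B : TopTree} (h : (node .c K A B).Valid T) :
    (node .c K A B).spinePath T = A.spinePath T := by
  obtain ⟨hA, -, -, -, -, -, x, -, h1, h2, h3, -, h4, -, h5⟩ := id h
  obtain ⟨u, hu⟩ := Option.ne_none_iff_exists'.1 h4
  rw [spinePath_of_bot hA hu, spinePath_of_bot h (h5.trans hu)]
  simp only [cluster_node, h1, h3]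

theorem spinePath_typeD {K : Cluster} {A B : TopTree} (h : (node .d K A B).Valid T) :
    (node .d K A B).spinePath T = B.spinePath T := by
  obtain ⟨-, hB, -, -, -, -, x, -, h1, h2, h3, -, -, h4, h5⟩ := id h
  obtain ⟨u, hu⟩ := Option.ne_none_iff_exists'.1 h4
  rw [spinePath_of_bot hB hu, spinePath_of_bot h (h5.trans hu)]
  simp only [cluster_node, h2, h3]

theorem spinePath_leaf {p : List ℕ} {i : ℕ} (hb : ((leaf p i).cluster T).bot ≠ none) :
    (leaf p i).spinePath T = [p ++ [i]] := by
  simp only [cluster, Cluster.edge] at hb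
  have hl : ¬ T.IsLeaf (p ++ [i]) := fun hl => hb (if_pos hl)
  simp only [spinePath, spineEnd, Cluster.edge, cluster, if_neg hl]
  exact List.drop_inits_concat p i

theorem bot_left_ne_none {K : Cluster} {A B : TopTree} {ty : MergeType} (hty : ty.IsVertical)
    (h : (node ty K A B).Valid T) : (A.cluster T).bot ≠ none := by
  obtain ⟨-, -, -, -, -, -, x, -, hx⟩ := h
  cases ty <;> simp_all [MergeType.Boundary, MergeType.IsVertical]

theorem bot_right_ne_none {K : Cluster} {A B : TopTree}
    (h : (node .a K A B).Valid T) : (B.cluster T).bot ≠ none := by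
  obtain ⟨-, -, -, -, -, -, x, -, hx⟩ := h
  exact hx.2.2.1

/-- Without a bottom boundary node only type (b) has a spine, and it lies in the left child. The
strict length bound is what separates the two sides of a merge in `spinePath_disjoint`. -/
theorem mem_spinePath {D : TopTree} (h : D.Valid T) {e : List ℕ} (he : e ∈ D.spinePath T) :
    e ∈ (D.cluster T).verts T ∧ (D.cluster T).top.length < e.length := by
  have key : ∀ {D : TopTree}, D.Valid T → (D.cluster T).bot ≠ none → e ∈ D.spinePath T →
      e ∈ (D.cluster T).verts T ∧ (D.cluster T).top.length < e.length := by
    intro D h hb he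
    obtain ⟨u, hu⟩ := Option.ne_none_iff_exists'.1 hb
    rw [spinePath_of_bot h hu] at he
    obtain ⟨h1, h2⟩ := List.mem_drop_inits.1 he
    exact ⟨h.isCluster.mem_verts_of_prefix_bot hu h1 h2, h2⟩
  by_cases hb : (D.cluster T).bot = none
  · cases D with
    | leaf p i => simp [spinePath, spineEnd, show (Cluster.edge T p i).bot = none from hb] at he
    | node ty K A B =>
      cases ty
      case b =>
        rw [spinePath_typeB h] at he
        have := key h.1 (bot_left_ne_none (by simp [MergeType.IsVertical]) h) he
        refine ⟨h.verts_subset (left_mem_subtrees _ _ _ _) this.1, ?_⟩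
        obtain ⟨-, -, -, -, -, -, x, -, hx⟩ := h
        simpa only [cluster_node, hx.2.2.2.1] using this.2
      all_goals simp [spinePath, spineEnd, show K.bot = none from hb] at he
  · exact key h hb he

/-- Spine paths below the two children of a merge share no edge. -/
theorem spinePath_disjoint {ty : MergeType} {K : Cluster} {A B D D' : TopTree}
    (h : (node ty K A B).Valid T) (hD : D ∈ A.subtrees) (hD' : D' ∈ B.subtrees) {e : List ℕ}
    (he : e ∈ D.spinePath T) (he' : e ∈ D'.spinePath T) : False := by
  obtain ⟨hA, hB, -, -, -, -, x, hx, hb⟩ := h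
  have vD' := hB.of_mem_subtrees hD'
  have h1 := hA.verts_subset hD (mem_spinePath (hA.of_mem_subtrees hD) he).1
  obtain ⟨h2, h3⟩ := mem_spinePath vD' he'
  have h4 : e ∈ ({x} : Set (List ℕ)) := hx ▸ ⟨h1, hB.verts_subset hD' h2⟩
  obtain rfl : e = x := h4
  -- The common node `e` is the top of `B`, hence no longer than the top of `D'`; yet it lies
  -- strictly below the latter.
  have h5 := (Cluster.top_prefix_of_mem_verts
    (hB.verts_subset hD' vD'.isCluster.top_mem_verts)).length_le
  rw [hb.top_right] at h5
  omega

/-! ### Children in the vertical top forest. -/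

/-- The vertical or leaf descendant that determines the spine path. -/
def core : TopTree → TopTree
  | node .c _ l _ => l.core
  | node .d _ _ r => r.core
  | t => t

theorem core_spec {A : TopTree} (h : A.Valid T) (hb : (A.cluster T).bot ≠ none) :
    A.core ∈ A.subtrees ∧ (A.core.IsVertical ∨ A.core.IsLeafCluster) ∧
      A.core.spinePath T = A.spinePath T ∧ (A.core.cluster T).bot ≠ none := by
  induction A with
  | leaf p i => exact ⟨rfl, Or.inr trivial, rfl, hb⟩
  | node ty K A B hA hB =>
    obtain ⟨-, -, -, -, -, -, x, -, hx⟩ := id h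
    cases ty
    case a => exact ⟨mem_subtrees_self _, Or.inl trivial, rfl, hb⟩
    case b => exact ⟨mem_subtrees_self _, Or.inl trivial, rfl, hb⟩
    case c =>
      obtain ⟨h1, h2, h3, h4⟩ := hA h.1 hx.2.2.2.2.1
      exact ⟨Or.inr (Or.inl h1), h2, h3.trans (spinePath_typeC h).symm, h4⟩
    case d =>
      obtain ⟨h1, h2, h3, h4⟩ := hB h.2.1 hx.2.2.2.2.2.1
      exact ⟨Or.inr (Or.inr h1), h2, h3.trans (spinePath_typeD h).symm, h4⟩
    case e => exact absurd hx.2.2.2.2.2.2 hb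

/-- A descendant on the wrong side of a merge has a spine path disjoint from the required one, and
below a type (a) merge no proper descendant meets the spines of both sides. Spines are nonempty
here, which supplies the offending edge. -/
theorem eq_core {A D : TopTree} (h : A.Valid T) (hb : (A.cluster T).bot ≠ none)
    (hD : D ∈ A.subtrees) (hv : D.IsVertical ∨ D.IsLeafCluster)
    (hs : D.spinePath T = A.spinePath T) : D = A.core := by
  induction A with
  | leaf p i => exact hD
  | node ty K A B hA hB =>
    obtain ⟨-, -, -, -, -, -, x, -, hx⟩ := id h
    have hne := spinePath_ne_nil h hb
    cases ty
    case a =>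
      have hAn := spinePath_ne_nil h.1 (bot_left_ne_none (by simp [MergeType.IsVertical]) h)
      have hBn := spinePath_ne_nil h.2.1 (bot_right_ne_none h)
      rw [spinePath_typeA h] at hs
      rcases hD with rfl | hD | hD
      · rfl
      · obtain ⟨e, he⟩ := List.exists_mem_of_ne_nil _ hBn
        exact (spinePath_disjoint h hD B.mem_subtrees_self (by rw [hs]; simp [he]) he).elim
      · obtain ⟨e, he⟩ := List.exists_mem_of_ne_nil _ hAn
        exact (spinePath_disjoint h A.mem_subtrees_self hD he (by rw [hs]; simp [he])).elim
    case b => exact absurd hx.2.2.2.2 hb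
    case c =>
      rw [spinePath_typeC h] at hs hne
      rcases hD with rfl | hD | hD
      · simp [IsVertical, IsLeafCluster, MergeType.IsVertical] at hv
      · exact hA h.1 hx.2.2.2.2.1 hD hs
      · obtain ⟨e, he⟩ := List.exists_mem_of_ne_nil _ hne
        exact (spinePath_disjoint h A.mem_subtrees_self hD he (by rwa [hs])).elim
    case d =>
      rw [spinePath_typeD h] at hs hne
      rcases hD with rfl | hD | hD
      · simp [IsVertical, IsLeafCluster, MergeType.IsVertical] at hv
      · obtain ⟨e, he⟩ := List.exists_mem_of_ne_nil _ hne
        exact (spinePath_disjoint h hD B.mem_subtrees_self (by rwa [hs]) he).elim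
      · exact hB h.2.1 hx.2.2.2.2.2.1 hD hs
    case e => exact absurd hx.2.2.2.2.2.2 hb

theorem ForestLeft.eq_core {τ D : TopTree} (h : τ.Valid T) (hD : ForestLeft T τ D) :
    ∃ ty K A B, τ = node ty K A B ∧ ty.IsVertical ∧ D = A.core := by
  obtain ⟨ty, K, A, B, rfl, hty, hm, hv, hs⟩ := hD
  refine ⟨ty, K, A, B, rfl, hty, ?_⟩
  have hb := bot_left_ne_none hty h
  rcases hm with hm | hm
  · exact TopTree.eq_core h.1 hb hm hv hs
  · obtain ⟨e, he⟩ := List.exists_mem_of_ne_nil _ (spinePath_ne_nil h.1 hb)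
    exact (spinePath_disjoint h A.mem_subtrees_self hm he (by rwa [hs])).elim

theorem ForestRight.eq_core {τ D : TopTree} (h : τ.Valid T) (hD : ForestRight T τ D) :
    ∃ K A B, τ = node .a K A B ∧ D = B.core := by
  obtain ⟨K, A, B, rfl, hm, hv, hs⟩ := hD
  refine ⟨K, A, B, rfl, ?_⟩
  have hb := bot_right_ne_none h
  rcases hm with hm | hm
  · obtain ⟨e, he⟩ := List.exists_mem_of_ne_nil _ (spinePath_ne_nil h.2.1 hb)
    exact (spinePath_disjoint h hm B.mem_subtrees_self (by rwa [hs]) he).elim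
  · exact TopTree.eq_core h.2.1 hb hm hv hs

/-- If the core is a leaf cluster, it has a bottom boundary node, so its edge lies on its own spine
path. -/
theorem core_mem_forestNodes {τ A : TopTree} (h : τ.Valid T) (hA : A ∈ τ.subtrees)
    (hb : (A.cluster T).bot ≠ none) : A.core ∈ τ.forestNodes T := by
  obtain ⟨h1, h2, h3, h4⟩ := core_spec (h.of_mem_subtrees hA) hb
  have hm := subtrees_trans h1 hA
  refine ⟨hm, h2.imp_right fun hl => ?_⟩
  cases hc : A.core with
  | leaf p i =>
    rw [hc] at h4 hm
    exact ⟨p, i, rfl, _, hm, by rw [spinePath_leaf h4]; simp⟩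
  | node ty K A B => simp [hc, IsLeafCluster] at hl

end TopTree

/-! ## The labelled trees of the vertical top DAG -/

namespace LabelTree

/-- The counterpart of `TopTree.core`. -/
def core {α : Type*} : LabelTree α → LabelTree α
  | node .c l _ => l.core
  | node .d _ r => r.core
  | t => t

end LabelTree

namespace TopTree

variable {α : Type*} {T : LabeledTree α}

/-- Makes the forest child a function of the labelled tree alone, so that child pointers in the DAG
are well defined. -/
theorem erase_core (A : TopTree) : A.core.erase T = (A.erase T).core := by
  induction A with
  | leaf p i => rfl
  | node ty K A B hA hB => cases ty <;> first | rfl | exact hA | exact hB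

theorem DagLeft.unique {τ : TopTree} (h : τ.Valid T) {X Y Y' : LabelTree α}
    (hY : τ.DagLeft T X Y) (hY' : τ.DagLeft T X Y') : Y = Y' := by
  obtain ⟨C, hC, D, -, hD, rfl, rfl⟩ := hY
  obtain ⟨C', hC', D', -, hD', he, rfl⟩ := hY'
  obtain ⟨ty, K, A, B, rfl, -, rfl⟩ := hD.eq_core (h.of_mem_subtrees hC.1)
  obtain ⟨ty', K', A', B', rfl, -, rfl⟩ := hD'.eq_core (h.of_mem_subtrees hC'.1)
  simp only [erase, LabelTree.node.injEq] at he
  rw [erase_core, erase_core, he.2.1]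

theorem DagRight.unique {τ : TopTree} (h : τ.Valid T) {X Y Y' : LabelTree α}
    (hY : τ.DagRight T X Y) (hY' : τ.DagRight T X Y') : Y = Y' := by
  obtain ⟨C, hC, D, -, hD, rfl, rfl⟩ := hY
  obtain ⟨C', hC', D', -, hD', he, rfl⟩ := hY'
  obtain ⟨K, A, B, rfl, rfl⟩ := hD.eq_core (h.of_mem_subtrees hC.1)
  obtain ⟨K', A', B', rfl, rfl⟩ := hD'.eq_core (h.of_mem_subtrees hC'.1)
  simp only [erase, LabelTree.node.injEq] at he
  rw [erase_core, erase_core, he.2.2]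

end TopTree

/-! ## Straight-line programs -/

/-- Straight-line programs, unfolded to binary trees: the string of a tree is read off its leaves. -/
inductive SLTree (α : Type*)
  | leaf (x : α)
  | cat (l r : SLTree α)

/-- The string of a straight-line program. -/
def SLTree.str {α : Type*} : SLTree α → List α
  | leaf x => [x]
  | cat l r => l.str ++ r.str

/-- The straight-line program for the spine of a cluster with the given labelled tree. -/
def LabelTree.toSL {α : Type*} : LabelTree α → SLTree α
  | leaf x => .leaf x
  | node .a l r => .cat l.toSL r.toSL
  | node .d _ r => r.toSL
  -- Types (b) and (c) inherit the spine of the left child; type (e) has no spine and its value is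
  -- arbitrary.
  | node _ l _ => l.toSL

theorem LabelTree.toSL_core {α : Type*} (X : LabelTree α) : X.core.toSL = X.toSL := by
  induction X with
  | leaf x => rfl
  | node ty l r hl hr => cases ty <;> first | rfl | exact hl | exact hr

namespace TopTree

variable {α : Type*} {T : LabeledTree α}

theorem spine_eq_of_bot {D : TopTree} (h : D.Valid T) (hb : (D.cluster T).bot ≠ none) :
    D.spine T = (D.erase T).toSL.str := by
  induction D with
  | leaf p i => simp [spine, spinePath_leaf hb, erase, LabelTree.toSL, SLTree.str]
  | node ty K A B hA hB =>
    obtain ⟨-, -, -, -, -, -, x, -, hx⟩ := id h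
    cases ty
    case a =>
      have hA' := hA h.1 (bot_left_ne_none (by simp [MergeType.IsVertical]) h)
      have hB' := hB h.2.1 (bot_right_ne_none h)
      simp only [spine] at hA' hB'
      simp only [spine, spinePath_typeA h, List.map_append, hA', hB', erase, LabelTree.toSL,
        SLTree.str]
    case b => exact absurd hx.2.2.2.2 hb
    case c =>
      simp only [spine, spinePath_typeC h]
      exact hA h.1 hx.2.2.2.2.1
    case d =>
      simp only [spine, spinePath_typeD h]
      exact hB h.2.1 hx.2.2.2.2.2.1
    case e => exact absurd hx.2.2.2.2.2.2 hb

theorem spine_eq_str {D : TopTree} (h : D.Valid T) (hv : D.IsVertical) :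
    D.spine T = (D.erase T).toSL.str := by
  cases D with
  | leaf p i => exact hv.elim
  | node ty K A B =>
    cases ty
    case a =>
      obtain ⟨-, -, -, -, -, -, x, -, hx⟩ := id h
      refine spine_eq_of_bot h ?_
      simp only [cluster_node, hx.2.2.2.2]
      exact hx.2.2.1
    case b =>
      simp only [spine, spinePath_typeB h]
      exact spine_eq_of_bot h.1 (bot_left_ne_none (by simp [MergeType.IsVertical]) h)
    all_goals exact hv.elim

/-- The straight-line programs of the nodes of the vertical top DAG are closed under children. -/
theorem children_mem_toSL_image {τ : TopTree} (h : τ.Valid T) {l r : SLTree α}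
    (hm : .cat l r ∈ LabelTree.toSL '' τ.dagNodes T) :
    l ∈ LabelTree.toSL '' τ.dagNodes T ∧ r ∈ LabelTree.toSL '' τ.dagNodes T := by
  have core_mem : ∀ {A : TopTree}, A ∈ τ.subtrees → (A.cluster T).bot ≠ none →
      (A.erase T).toSL ∈ LabelTree.toSL '' τ.dagNodes T := fun {A} hA hb =>
    ⟨_, ⟨_, core_mem_forestNodes h hA hb, rfl⟩, by simp only [erase_core, LabelTree.toSL_core]⟩
  have key : ∀ {D : TopTree}, D ∈ τ.subtrees → (D.IsVertical ∨ D.IsLeafCluster) →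
      (D.cluster T).bot ≠ none → (D.erase T).toSL = .cat l r →
      l ∈ LabelTree.toSL '' τ.dagNodes T ∧ r ∈ LabelTree.toSL '' τ.dagNodes T := by
    intro D hD hv hb he
    cases D with
    | leaf p i => simp [erase, LabelTree.toSL] at he
    | node ty K A B =>
      have hval := h.of_mem_subtrees hD
      cases ty
      case a =>
        simp only [erase, LabelTree.toSL, SLTree.cat.injEq] at he
        rw [← he.1, ← he.2]
        exact ⟨core_mem (subtrees_trans (left_mem_subtrees _ _ _ _) hD)
            (bot_left_ne_none (by simp [MergeType.IsVertical]) hval),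
          core_mem (subtrees_trans (right_mem_subtrees _ _ _ _) hD)
            (bot_right_ne_none hval)⟩
      case b =>
        obtain ⟨-, -, -, -, -, -, x, -, hx⟩ := hval
        exact absurd hx.2.2.2.2 hb
      all_goals exact (hv.elim id id).elim
  have key' : ∀ {A : TopTree}, A ∈ τ.subtrees → (A.cluster T).bot ≠ none →
      (A.erase T).toSL = .cat l r →
      l ∈ LabelTree.toSL '' τ.dagNodes T ∧ r ∈ LabelTree.toSL '' τ.dagNodes T := by
    intro A hA hb he
    obtain ⟨h1, h2, -, h4⟩ := core_spec (h.of_mem_subtrees hA) hb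
    exact key (subtrees_trans h1 hA) h2 h4 (by rw [erase_core, LabelTree.toSL_core, he])
  obtain ⟨X, ⟨C, ⟨hC, hv⟩, rfl⟩, he⟩ := hm
  cases C with
  | leaf p i => simp [erase, LabelTree.toSL] at he
  | node ty K A B =>
    have hval := h.of_mem_subtrees hC
    have hvert : (node ty K A B).IsVertical := by simpa using hv
    cases ty
    case a =>
      obtain ⟨-, -, -, -, -, -, x, -, hx⟩ := id hval
      refine key hC (Or.inl trivial) ?_ he
      simp only [cluster_node, hx.2.2.2.2]
      exact hx.2.2.1
    -- The program is that of the left child, which has a bottom boundary node, so its core falls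
    -- under `key`.
    case b =>
      exact key' (subtrees_trans (left_mem_subtrees _ _ _ _) hC)
        (bot_left_ne_none (by simp [MergeType.IsVertical]) hval) he
    all_goals exact hvert.elim

end TopTree

/-! ### Leftmost paths, with depths counted from the leaf upwards. -/

namespace SLTree

variable {α : Type*}

/-- The length of the leftmost path. -/
def depth : SLTree α → ℕ
  | leaf _ => 0
  | cat l _ => l.depth + 1

/-- The node of depth `d` on the leftmost path (the tree itself if its depth is at most `d`). -/
def onPath : SLTree α → ℕ → SLTree α
  | leaf x, _ => leaf x
  | cat l r, d => if l.depth < d then cat l r else l.onPath d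

/-- The part of the string that is to the right of the node of depth `d` on the leftmost path. -/
def after : SLTree α → ℕ → List α
  | leaf _, _ => []
  | cat l r, d => if l.depth < d then [] else l.after d ++ r.str

/-- The first character. -/
def first : SLTree α → α
  | leaf x => x
  | cat l _ => l.first

theorem str_ne_nil (x : SLTree α) : x.str ≠ [] := by
  induction x with
  | leaf x => simp [str]
  | cat l r hl hr => simp [str, hl]

theorem onPath_eq_self {x : SLTree α} {d : ℕ} (h : x.depth ≤ d) : x.onPath d = x := by
  cases x with
  | leaf x => rfl
  | cat l r => exact if_pos h

theorem onPath_cat {l r : SLTree α} {d : ℕ} (h : d ≤ l.depth) :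
    (cat l r).onPath d = l.onPath d :=
  if_neg (not_lt.2 h)

theorem depth_onPath {x : SLTree α} {d : ℕ} (h : d ≤ x.depth) : (x.onPath d).depth = d := by
  induction x with
  | leaf x => exact (Nat.le_zero.1 h).symm
  | cat l r hl hr =>
    rcases h.eq_or_lt with rfl | h
    · rw [onPath_eq_self le_rfl]
    · have h : d ≤ l.depth := Nat.lt_succ_iff.1 h
      rw [onPath_cat h, hl h]

theorem onPath_onPath (x : SLTree α) {d e : ℕ} (h : d ≤ e) :
    (x.onPath e).onPath d = x.onPath d := by
  induction x with
  | leaf x => rfl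
  | cat l r hl hr =>
    by_cases he : l.depth < e
    · simp [onPath, he]
    · have he : e ≤ l.depth := not_lt.1 he
      rw [onPath_cat he, onPath_cat (h.trans he), hl]

theorem first_cons_after (x : SLTree α) : x.str = x.first :: x.after 0 := by
  induction x with
  | leaf x => rfl
  | cat l r hl hr => simp [str, first, after, hl]

theorem after_eq_nil {x : SLTree α} {d : ℕ} (h : x.depth ≤ d) : x.after d = [] := by
  cases x with
  | leaf x => rfl
  | cat l r => exact if_pos h

theorem after_cat {l r : SLTree α} {d : ℕ} (h : d ≤ l.depth) :
    (cat l r).after d = l.after d ++ r.str :=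
  if_neg (not_lt.2 h)

/-- One step up the leftmost path: the right child of the node of depth `d + 1` is what has to be
reported next. -/
theorem after_eq {x : SLTree α} {d : ℕ} (h : d < x.depth) :
    ∃ l r, x.onPath (d + 1) = cat l r ∧ x.after d = r.str ++ x.after (d + 1) := by
  induction x with
  | leaf x => simp [depth] at h
  | cat l r hl hr =>
    rcases (Nat.lt_succ_iff.1 h : d ≤ l.depth).eq_or_lt with rfl | h
    · refine ⟨l, r, onPath_eq_self le_rfl, ?_⟩
      rw [after_cat le_rfl, after_eq_nil le_rfl, after_eq_nil (x := cat l r) (d := l.depth + 1) le_rfl]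
      simp
    · obtain ⟨l', r', h1, h2⟩ := hl h
      refine ⟨l', r', by rw [onPath_cat h, h1], ?_⟩
      rw [after_cat h.le, after_cat h, h2, List.append_assoc]

/-- A set of straight-line programs that contains with a tree also its children. -/
def Closed (U : Set (SLTree α)) : Prop :=
  ∀ l r, cat l r ∈ U → l ∈ U ∧ r ∈ U

theorem Closed.onPath_mem {U : Set (SLTree α)} (hU : Closed U) {x : SLTree α} (hx : x ∈ U)
    (d : ℕ) : x.onPath d ∈ U := by
  induction x with
  | leaf x => exact hx
  | cat l r hl hr =>
    unfold onPath
    split_ifs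
    · exact hx
    · exact hl (hU _ _ hx).1

/-! ### Anchors, and lists spread over leftmost paths. -/

/-- The depth of the anchor of a node of depth `k`: a power of two between `k / 4` and
`(k + 1) / 2`. -/
def anchorDepth (k : ℕ) : ℕ := 2 ^ (Nat.log 2 k - 1)

theorem anchorDepth_spec {k : ℕ} (h : 0 < k) :
    2 * anchorDepth k ≤ k + 1 ∧ k < 4 * anchorDepth k := by
  unfold anchorDepth
  have h1 := Nat.pow_log_le_self 2 h.ne'
  have h2 := Nat.lt_pow_succ_log_self (b := 2) (by norm_num) k
  cases hl : Nat.log 2 k with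
  -- Here `k = 1`, and truncated subtraction makes the anchor depth 1; this case forces `k + 1` in
  -- the first bound.
  | zero =>
    rw [hl] at h2
    simp at h2 ⊢
    omega
  | succ n =>
    rw [hl] at h1 h2
    simp only [pow_succ, Nat.add_sub_cancel] at h1 h2 ⊢
    omega

/-- The anchor of `x`: a node on its leftmost path, at about a third of its depth. -/
def anchor (x : SLTree α) : SLTree α := x.onPath (anchorDepth x.depth)

/-- `y` is on a leftmost path through `u` and deep enough to store a list of the nodes on the
leftmost path of `u`. -/
def IsCarrier (U : Set (SLTree α)) (u y : SLTree α) : Prop :=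
  y ∈ U ∧ y.onPath u.depth = u ∧ 2 * u.depth ≤ y.depth + 1

open Classical in
/-- A carrier of `u` if there is one. -/
noncomputable def carrier (U : Set (SLTree α)) (u : SLTree α) : SLTree α :=
  -- One choice per `u`, so that all nodes with anchor `u` share a single list. The default only
  -- keeps pointers inside `U`; the query never relies on it.
  if h : ∃ y, IsCarrier U u y then h.choose else u

/-- The greatest power of two that is at most `k`. -/
def blockStart (k : ℕ) : ℕ := 2 ^ Nat.log 2 k

/-- The successor of `w` in the list that it is part of. -/
noncomputable def next (U : Set (SLTree α)) (w : SLTree α) : SLTree α :=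
  (carrier U (w.onPath (blockStart w.depth))).onPath (w.depth + 1)

/-- The list element that is stored in `w`. -/
def item (w : SLTree α) : SLTree α := w.onPath (w.depth - blockStart w.depth + 1)

theorem anchor_mem {U : Set (SLTree α)} (hU : Closed U) {x : SLTree α} (hx : x ∈ U) :
    x.anchor ∈ U :=
  hU.onPath_mem hx _

theorem item_mem {U : Set (SLTree α)} (hU : Closed U) {x : SLTree α} (hx : x ∈ U) :
    x.item ∈ U :=
  hU.onPath_mem hx _

theorem carrier_mem {U : Set (SLTree α)} {u : SLTree α} (hu : u ∈ U) : carrier U u ∈ U := by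
  unfold carrier
  split_ifs with h
  · exact h.choose_spec.1
  · exact hu

theorem next_mem {U : Set (SLTree α)} (hU : Closed U) {x : SLTree α} (hx : x ∈ U) :
    x.next U ∈ U :=
  hU.onPath_mem (carrier_mem (hU.onPath_mem hx _)) _

theorem depth_anchor {x : SLTree α} (h : 0 < x.depth) :
    x.anchor.depth = anchorDepth x.depth :=
  depth_onPath (by have := anchorDepth_spec h; omega)

/-- A carrier exists because `x` itself is one; the chosen carrier may be a different tree. -/
theorem isCarrier_carrier {U : Set (SLTree α)} {x : SLTree α} (hx : x ∈ U) (h : 0 < x.depth) :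
    IsCarrier U x.anchor (carrier U x.anchor) := by
  have hex : ∃ y, IsCarrier U x.anchor y := by
    refine ⟨x, hx, ?_, ?_⟩
    · rw [depth_anchor h]; rfl
    · rw [depth_anchor h]; exact (anchorDepth_spec h).1
  unfold carrier
  rw [dif_pos hex]
  exact hex.choose_spec

/-- The `j`-th node that carries an element of the list for `u`. -/
noncomputable def listNode (U : Set (SLTree α)) (u : SLTree α) (j : ℕ) : SLTree α :=
  (carrier U u).onPath (u.depth + j)

section

variable {U : Set (SLTree α)} {u : SLTree α} {j : ℕ}

theorem listNode_mem (hU : Closed U) (hu : u ∈ U) : listNode U u j ∈ U :=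
  hU.onPath_mem (carrier_mem hu) _

theorem listNode_zero (hc : IsCarrier U u (carrier U u)) : listNode U u 0 = u := hc.2.1

theorem depth_listNode (hc : IsCarrier U u (carrier U u)) (hj : j < u.depth) :
    (listNode U u j).depth = u.depth + j :=
  depth_onPath (by have := hc.2.2; omega)

theorem blockStart_eq {e j : ℕ} (hj : j < 2 ^ e) : blockStart (2 ^ e + j) = 2 ^ e := by
  unfold blockStart
  rw [Nat.log_eq_of_pow_le_of_lt_pow (m := e) (by omega) (by rw [pow_succ]; omega)]

/-- The carrier passes through `u`, so up to depth `u.depth` both have the same leftmost path, and a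
list node finds the element on its own path. -/
theorem item_listNode {e : ℕ} (he : u.depth = 2 ^ e) (hc : IsCarrier U u (carrier U u))
    (hj : j < u.depth) : (listNode U u j).item = u.onPath (j + 1) := by
  unfold item
  rw [depth_listNode hc hj, he, blockStart_eq (he ▸ hj), Nat.add_sub_cancel_left, listNode,
    onPath_onPath _ (by omega)]
  conv_rhs => rw [← hc.2.1, onPath_onPath _ (by omega)]

/-- All nodes of the list compute the same block start `u`, hence the same carrier. The successor of
the last one is never loaded. -/
theorem next_listNode {e : ℕ} (he : u.depth = 2 ^ e) (hc : IsCarrier U u (carrier U u))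
    (hj : j < u.depth) : (listNode U u j).next U = listNode U u (j + 1) := by
  unfold next
  rw [depth_listNode hc hj, he, blockStart_eq (he ▸ hj), listNode, onPath_onPath _ (by omega),
    ← he, hc.2.1]
  rfl

end

end SLTree

/-! ## Runs of pointer machines -/

namespace PointerProgram

variable {α : Type*} {P : PointerProgram}

theorem out_prefix_step (s : Config P α) : s.out <+: (P.step s).out := by
  unfold step
  split <;> try exact List.prefix_rfl
  all_goals split <;> try exact List.prefix_rfl
  all_goals split <;> try exact List.prefix_rfl
  exact List.prefix_append _ _

theorem heap_prefix_step (hP : ∀ x i v, Instr.store x i v ∉ P.code) (s : Config P α) :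
    s.heap <+: (P.step s).heap := by
  unfold step
  split <;> try exact List.prefix_rfl
  case h_5 x i v h => exact absurd (List.mem_of_getElem? h) (hP x i v)
  case h_6 => exact List.prefix_append _ _
  all_goals split <;> try exact List.prefix_rfl
  split <;> exact List.prefix_rfl

theorem step_iterate_add (s : Config P α) (m n : ℕ) :
    P.step^[m + n] s = P.step^[n] (P.step^[m] s) := by
  rw [Nat.add_comm, Function.iterate_add_apply]

theorem out_prefix_iterate (s : Config P α) (n : ℕ) : s.out <+: (P.step^[n] s).out := by
  induction n with
  | zero => exact List.prefix_rfl
  | succ n ih =>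
    rw [Function.iterate_succ_apply']
    exact ih.trans (out_prefix_step _)

theorem heap_prefix_iterate (hP : ∀ x i v, Instr.store x i v ∉ P.code) (s : Config P α) (n : ℕ) :
    s.heap <+: (P.step^[n] s).heap := by
  induction n with
  | zero => exact List.prefix_rfl
  | succ n ih =>
    rw [Function.iterate_succ_apply']
    exact ih.trans (heap_prefix_step hP _)

theorem out_run_prefix (H : List (Cell P.fields α)) (entry : ℕ) {m n : ℕ} (h : m ≤ n) :
    (P.run H entry m).out <+: (P.run H entry n).out := by
  obtain ⟨k, rfl⟩ := Nat.exists_eq_add_of_le h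
  unfold run
  rw [step_iterate_add]
  exact out_prefix_iterate _ _

theorem iterate_of_halt {s : Config P α} (h : P.code[s.pc]? = some .halt) (n : ℕ) :
    P.step^[n] s = s := by
  have : P.step s = s := by unfold step; rw [h]
  exact Function.iterate_fixed this n

/-- A program that never overwrites memory extracts a string online if it reports every prefix in
time. -/
theorem extractsOnline_of_forall_prefix (hP : ∀ x i v, Instr.store x i v ∉ P.code) {c : ℕ}
    {H : List (Cell P.fields α)} {entry : ℕ} {s : List α}
    (h : ∀ ℓ ≤ s.length, ∃ t ≤ c * ℓ, (P.run H entry t).out = s.take ℓ)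
    (hh : ∃ t ≤ c * s.length, (P.run H entry t).out = s ∧
      P.code[(P.run H entry t).pc]? = some .halt) :
    P.ExtractsOnline c H entry s := by
  obtain ⟨t₀, ht₀, hout, hhalt⟩ := hh
  have hfin : ∀ t, t₀ ≤ t → P.run H entry t = P.run H entry t₀ := by
    intro t ht
    obtain ⟨k, rfl⟩ := Nat.exists_eq_add_of_le ht
    unfold run
    rw [step_iterate_add]
    exact iterate_of_halt hhalt k
  refine ⟨fun t => ⟨heap_prefix_iterate hP (P.init H entry) t, ?_⟩, fun ℓ hℓ => ?_, ?_, ?_⟩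
  · rw [← hout, ← hfin _ (le_max_right t t₀)]
    exact out_run_prefix H entry (le_max_left t t₀)
  · obtain ⟨t, ht, he⟩ := h ℓ hℓ
    rw [← he]
    exact out_run_prefix H entry ht
  · rw [hfin _ ht₀, hout]
  · rw [hfin _ ht₀, hhalt]

/-- The machine gets from `s` to `s'` in at most `n` steps. -/
def Steps (n : ℕ) (s s' : Config P α) : Prop := ∃ t ≤ n, P.step^[t] s = s'

namespace Steps

variable {m n : ℕ} {s s' s'' : Config P α}

theorem refl (s : Config P α) : Steps n s s := ⟨0, Nat.zero_le _, rfl⟩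

theorem trans (h : Steps m s s') (h' : Steps n s' s'') : Steps (m + n) s s'' := by
  obtain ⟨t, ht, rfl⟩ := h
  obtain ⟨t', ht', rfl⟩ := h'
  exact ⟨t + t', add_le_add ht ht', step_iterate_add _ _ _⟩

theorem mono (h : Steps m s s') (hmn : m ≤ n) : Steps n s s' := by
  obtain ⟨t, ht, h⟩ := h
  exact ⟨t, ht.trans hmn, h⟩

theorem head (h : P.step s = s') (h' : Steps n s' s'') : Steps (n + 1) s s'' := by
  obtain ⟨t, ht, h'⟩ := h'
  exact ⟨t + 1, by omega, by rw [Function.iterate_succ_apply, h, h']⟩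

variable {pc : ℕ} {reg : Fin (P.regs + 1) → Option ℕ} {heap : List (Cell P.fields α)} {o : List α}

theorem load {d x : Fin (P.regs + 1)} {i : Fin P.fields} {a : ℕ} {cell : Cell P.fields α}
    (hc : P.code[pc]? = some (.load d x i)) (ha : reg x = some a) (hh : heap[a]? = some cell)
    (h : Steps n ⟨pc + 1, Function.update reg d (cell.ptr i), heap, o⟩ s'') :
    Steps (n + 1) ⟨pc, reg, heap, o⟩ s'' := by
  refine head ?_ h
  simp only [step, hc, ha, hh, Option.bind_some]

theorem alloc {d : Fin (P.regs + 1)} {src : Fin P.fields → Fin (P.regs + 1)}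
    (hc : P.code[pc]? = some (.alloc d src))
    (h : Steps n ⟨pc + 1, Function.update reg d (some heap.length),
      heap ++ [⟨fun i => reg (src i), none⟩], o⟩ s'') :
    Steps (n + 1) ⟨pc, reg, heap, o⟩ s'' := by
  refine head ?_ h
  simp only [step, hc]

theorem jumpNull_of_eq {x : Fin (P.regs + 1)} {t : ℕ} (hc : P.code[pc]? = some (.jumpNull x t))
    (hx : reg x = none) (h : Steps n ⟨t, reg, heap, o⟩ s'') :
    Steps (n + 1) ⟨pc, reg, heap, o⟩ s'' := by
  refine head ?_ h
  simp only [step, hc, hx, if_true]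

theorem jumpNull_of_ne {x : Fin (P.regs + 1)} {t : ℕ} (hc : P.code[pc]? = some (.jumpNull x t))
    (hx : reg x ≠ none) (h : Steps n ⟨pc + 1, reg, heap, o⟩ s'') :
    Steps (n + 1) ⟨pc, reg, heap, o⟩ s'' := by
  refine head ?_ h
  simp only [step, hc, hx, if_false]

theorem jumpEq_of_eq {x y : Fin (P.regs + 1)} {t : ℕ} (hc : P.code[pc]? = some (.jumpEq x y t))
    (hx : reg x = reg y) (h : Steps n ⟨t, reg, heap, o⟩ s'') :
    Steps (n + 1) ⟨pc, reg, heap, o⟩ s'' := by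
  refine head ?_ h
  simp only [step, hc, hx, if_true]

theorem jumpEq_of_ne {x y : Fin (P.regs + 1)} {t : ℕ} (hc : P.code[pc]? = some (.jumpEq x y t))
    (hx : reg x ≠ reg y) (h : Steps n ⟨pc + 1, reg, heap, o⟩ s'') :
    Steps (n + 1) ⟨pc, reg, heap, o⟩ s'' := by
  refine head ?_ h
  simp only [step, hc, hx, if_false]

theorem output {x : Fin (P.regs + 1)} {a : ℕ} {cell : Cell P.fields α} {ch : α}
    (hc : P.code[pc]? = some (.output x)) (ha : reg x = some a) (hh : heap[a]? = some cell)
    (hd : cell.data = some ch) (h : Steps n ⟨pc + 1, reg, heap, o ++ [ch]⟩ s'') :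
    Steps (n + 1) ⟨pc, reg, heap, o⟩ s'' := by
  refine head ?_ h
  simp only [step, hc, ha, hh, Option.bind_some, hd]

end Steps

end PointerProgram

/-! ## The query program -/

/-- The program for spine path extraction. Register `0` holds the current node, `1` the stack; `2`,
`3`, `4` hold the fields of the topmost frame, `5` is a temporary register, and `6` is null. -/
abbrev spineProgram : PointerProgram where
  fields := 5
  regs := 6
  code :=
    -- Fields of a program node: left, right, anchor, successor, item. Fields of a frame: rest of
    -- the stack, tree or `u`, list node (null marks a tree frame), `w`. Instructions 0–1 start, 2–7
    -- pop a frame, 8–19 descend three times, 20–24 advance in the list, 25–30 report a character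
    -- and push the new list.
    [.load 0 0 2, .alloc 1 ![1, 0, 6, 6, 6],
      .jumpNull 1 31, .load 2 1 1, .load 3 1 2, .load 4 1 3, .load 1 1 0, .jumpNull 3 25,
      .jumpEq 4 2 12, .load 5 4 1, .alloc 1 ![1, 5, 6, 6, 6], .load 4 4 0,
      .jumpEq 4 2 16, .load 5 4 1, .alloc 1 ![1, 5, 6, 6, 6], .load 4 4 0,
      .jumpEq 4 2 20, .load 5 4 1, .alloc 1 ![1, 5, 6, 6, 6], .load 4 4 0,
      .load 0 3 4, .jumpEq 0 2 24, .load 3 3 3, .alloc 1 ![1, 2, 3, 4, 6], .load 2 0 1,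
      .output 2, .load 5 2 0, .jumpNull 5 2, .load 5 2 2, .alloc 1 ![1, 5, 5, 2, 6],
      .jumpNull 6 2, .halt]

/-! ### The stack of pending tasks and its representation in memory. -/

namespace SLTree

/-- A pending task of the query: to report the string of a tree, or to report the part of the string
of `w` to the right of the node of depth `j` on its leftmost path, where `u` is on that path and the
list for `u` is used. -/
inductive Frame (α : Type*)
  | tree (x : SLTree α)
  | list (u w : SLTree α) (j : ℕ)

variable {α : Type*}

/-- The string that is to be reported. -/
def Frame.str : Frame α → List α
  | tree x => x.str
  | list _ w j => w.after j

/-- The invariant of a frame; it guarantees that the descent from `w` reaches `u` in time. -/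
def Frame.Good (U : Set (SLTree α)) : Frame α → Prop
  | tree x => x ∈ U
  | list u w j => u ∈ U ∧ w ∈ U ∧ (∃ e, u.depth = 2 ^ e) ∧ IsCarrier U u (carrier U u) ∧
      -- The last inequality says that `u` is at most `3 * (u.depth - j)` edges below `w`: three for
      -- each remaining round.
      j < u.depth ∧ w.onPath u.depth = u ∧ u.depth ≤ w.depth ∧ w.depth + 3 * j ≤ 4 * u.depth

/-- The string that is to be reported for a stack of frames. -/
def stackStr (S : List (Frame α)) : List α := S.flatMap Frame.str

theorem stackStr_cons (f : Frame α) (S : List (Frame α)) :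
    stackStr (f :: S) = f.str ++ stackStr S := rfl

theorem Frame.Good.str_ne_nil {U : Set (SLTree α)} {f : Frame α} (h : f.Good U) : f.str ≠ [] := by
  cases f with
  | tree x => exact x.str_ne_nil
  | list u w j =>
    obtain ⟨-, -, -, -, h1, -, h2, -⟩ := h
    obtain ⟨l, r, -, h⟩ := after_eq (x := w) (d := j) (h1.trans_le h2)
    simp [Frame.str, h, r.str_ne_nil]

/-- The memory node of `x` has the right contents. -/
def CellSpec (U : Set (SLTree α)) (adr : SLTree α → ℕ) (x : SLTree α) (cell : Cell 5 α) : Prop :=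
  cell.data = some x.first ∧ (x.depth = 0 → cell.ptr 0 = none) ∧
    ∀ l r, x = cat l r → cell.ptr 0 = some (adr l) ∧ cell.ptr 1 = some (adr r) ∧
      cell.ptr 2 = some (adr x.anchor) ∧ cell.ptr 3 = some (adr (x.next U)) ∧
      cell.ptr 4 = some (adr x.item)

/-- All trees of `U` are stored in the heap, at different addresses. -/
def Stored (U : Set (SLTree α)) (adr : SLTree α → ℕ) (heap : List (Cell 5 α)) : Prop :=
  Set.InjOn adr U ∧ ∀ x ∈ U, ∃ cell, heap[adr x]? = some cell ∧ CellSpec U adr x cell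

/-- The frames of a stack are stored in the heap as a linked list. -/
inductive StackAt (U : Set (SLTree α)) (adr : SLTree α → ℕ) (heap : List (Cell 5 α)) :
    Option ℕ → List (Frame α) → Prop
  | nil : StackAt U adr heap none []
  | tree {p : ℕ} {cell : Cell 5 α} {x : SLTree α} {S : List (Frame α)} (h : heap[p]? = some cell)
      (h1 : cell.ptr 1 = some (adr x)) (h2 : cell.ptr 2 = none)
      (hS : StackAt U adr heap (cell.ptr 0) S) : StackAt U adr heap (some p) (.tree x :: S)
  | list {p : ℕ} {cell : Cell 5 α} {u w : SLTree α} {j : ℕ} {S : List (Frame α)}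
      (h : heap[p]? = some cell) (h1 : cell.ptr 1 = some (adr u))
      (h2 : cell.ptr 2 = some (adr (listNode U u j))) (h3 : cell.ptr 3 = some (adr w))
      (hS : StackAt U adr heap (cell.ptr 0) S) : StackAt U adr heap (some p) (.list u w j :: S)

theorem _root_.List.IsPrefix.getElem?_of_eq_some {β : Type*} {l l' : List β} (h : l <+: l') {n : ℕ}
    {a : β} (ha : l[n]? = some a) : l'[n]? = some a := by
  obtain ⟨t, rfl⟩ := h
  rw [List.getElem?_append_left (List.getElem?_eq_some_iff.1 ha).1, ha]

variable {U : Set (SLTree α)} {adr : SLTree α → ℕ} {heap : List (Cell 5 α)}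

theorem StackAt.mono {heap' : List (Cell 5 α)} (hh : heap <+: heap') {p : Option ℕ}
    {S : List (Frame α)} (h : StackAt U adr heap p S) : StackAt U adr heap' p S := by
  induction h with
  | nil => exact .nil
  | tree h h1 h2 _ ih => exact .tree (hh.getElem?_of_eq_some h) h1 h2 ih
  | list h h1 h2 h3 _ ih => exact .list (hh.getElem?_of_eq_some h) h1 h2 h3 ih

theorem Stored.mono {heap' : List (Cell 5 α)} (hh : heap <+: heap') (h : Stored U adr heap) :
    Stored U adr heap' := by
  refine ⟨h.1, fun x hx => ?_⟩
  obtain ⟨cell, h1, h2⟩ := h.2 x hx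
  exact ⟨cell, hh.getElem?_of_eq_some h1, h2⟩

/-- A configuration of the query program: the stack register points to the stack `S`. -/
structure Ready (U : Set (SLTree α)) (adr : SLTree α → ℕ) (heap : List (Cell 5 α))
    (p : Option ℕ) (S : List (Frame α)) : Prop where
  closed : Closed U
  stored : Stored U adr heap
  stack : StackAt U adr heap p S
  good : ∀ f ∈ S, f.Good U

theorem Ready.pushTree {p : Option ℕ} {S : List (Frame α)} (h : Ready U adr heap p S)
    {x : SLTree α} (hx : x ∈ U) {f : Fin 5 → Option ℕ} (h0 : f 0 = p) (h1 : f 1 = some (adr x))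
    (h2 : f 2 = none) :
    Ready U adr (heap ++ [⟨f, none⟩]) (some heap.length) (.tree x :: S) where
  closed := h.closed
  stored := h.stored.mono (List.prefix_append _ _)
  stack := .tree (by simp; rfl) h1 h2 (by simpa only [h0] using h.stack.mono (List.prefix_append _ _))
  good := by simpa using ⟨hx, h.good⟩

theorem Ready.pushList {p : Option ℕ} {S : List (Frame α)} (h : Ready U adr heap p S)
    {u w : SLTree α} {j : ℕ} (hg : (Frame.list u w j).Good U) {f : Fin 5 → Option ℕ}
    (h0 : f 0 = p) (h1 : f 1 = some (adr u)) (h2 : f 2 = some (adr (listNode U u j)))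
    (h3 : f 3 = some (adr w)) :
    Ready U adr (heap ++ [⟨f, none⟩]) (some heap.length) (.list u w j :: S) where
  closed := h.closed
  stored := h.stored.mono (List.prefix_append _ _)
  stack := .list (by simp; rfl) h1 h2 h3
    (by simpa only [h0] using h.stack.mono (List.prefix_append _ _))
  good := by simpa using ⟨hg, h.good⟩

/-- The contents of the registers. -/
def regs (r₀ r₁ r₂ r₃ r₄ r₅ : Option ℕ) : Fin 7 → Option ℕ := ![r₀, r₁, r₂, r₃, r₄, r₅, none]

section

variable (r₀ r₁ r₂ r₃ r₄ r₅ v : Option ℕ)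

theorem update_regs_zero :
    Function.update (regs r₀ r₁ r₂ r₃ r₄ r₅) 0 v = regs v r₁ r₂ r₃ r₄ r₅ := by
  funext i; fin_cases i <;> rfl

theorem update_regs_one :
    Function.update (regs r₀ r₁ r₂ r₃ r₄ r₅) 1 v = regs r₀ v r₂ r₃ r₄ r₅ := by
  funext i; fin_cases i <;> rfl

theorem update_regs_two :
    Function.update (regs r₀ r₁ r₂ r₃ r₄ r₅) 2 v = regs r₀ r₁ v r₃ r₄ r₅ := by
  funext i; fin_cases i <;> rfl

theorem update_regs_three :
    Function.update (regs r₀ r₁ r₂ r₃ r₄ r₅) 3 v = regs r₀ r₁ r₂ v r₄ r₅ := by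
  funext i; fin_cases i <;> rfl

theorem update_regs_four :
    Function.update (regs r₀ r₁ r₂ r₃ r₄ r₅) 4 v = regs r₀ r₁ r₂ r₃ v r₅ := by
  funext i; fin_cases i <;> rfl

theorem update_regs_five :
    Function.update (regs r₀ r₁ r₂ r₃ r₄ r₅) 5 v = regs r₀ r₁ r₂ r₃ r₄ v := by
  funext i; fin_cases i <;> rfl

end

/-- A configuration of the query program. -/
def config (pc : ℕ) (r₀ r₁ r₂ r₃ r₄ r₅ : Option ℕ) (heap : List (Cell 5 α)) (o : List α) :
    PointerProgram.Config spineProgram α :=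
  ⟨pc, regs r₀ r₁ r₂ r₃ r₄ r₅, heap, o⟩

/-! ### Correctness and running time of a round. -/

open PointerProgram

variable {r₀ r₁ r₂ r₃ r₄ r₅ : Option ℕ} {o : List α} {S : List (Frame α)}

/-- One step of the descent on a leftmost path. -/
theorem descend {pc : ℕ} (hc0 : spineProgram.code[pc]? = some (.jumpEq 4 2 (pc + 4)))
    (hc1 : spineProgram.code[pc + 1]? = some (.load 5 4 1))
    (hc2 : spineProgram.code[pc + 2]? = some (.alloc 1 ![1, 5, 6, 6, 6]))
    (hc3 : spineProgram.code[pc + 3]? = some (.load 4 4 0))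
    {u w : SLTree α} (hR : Ready U adr heap r₁ S) (hu : u ∈ U) (hw : w ∈ U)
    (huw : w.onPath u.depth = u) (hd : u.depth ≤ w.depth) :
    ∃ r₁' r₅' heap' w' S',
      Steps 4 (config pc r₀ r₁ (some (adr u)) r₃ (some (adr w)) r₅ heap o)
        (config (pc + 4) r₀ r₁' (some (adr u)) r₃ (some (adr w')) r₅' heap' o) ∧
      Ready U adr heap' r₁' S' ∧ w' ∈ U ∧ w'.onPath u.depth = u ∧ u.depth ≤ w'.depth ∧
      w'.depth ≤ max u.depth (w.depth - 1) ∧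
      ∀ j ≤ u.depth, w.after j ++ stackStr S = w'.after j ++ stackStr S' := by
  by_cases h : w = u
  · subst h
    refine ⟨r₁, r₅, heap, w, S, ?_, hR, hw, huw, le_rfl, by simp, fun _ _ => rfl⟩
    exact Steps.jumpEq_of_eq hc0 rfl (Steps.refl _)
  · cases w with
    | leaf x => exact absurd (by simpa [onPath] using huw) h
    | cat l r =>
      -- Otherwise `onPath` returns the whole tree, and `w` would be `u`.
      have hd' : u.depth ≤ l.depth := by
        by_contra hlt
        exact h (by rwa [onPath_eq_self (Nat.lt_of_not_le hlt)] at huw)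
      obtain ⟨hl, hr⟩ := hR.closed _ _ hw
      obtain ⟨cell, hcell, -, -, hs⟩ := hR.stored.2 _ hw
      obtain ⟨h0, h1, -⟩ := hs l r rfl
      refine ⟨_, some (adr r), _, l, .tree r :: S, ?_,
        hR.pushTree (f := fun i => regs r₀ r₁ (some (adr u)) r₃ (some (adr (cat l r)))
          (some (adr r)) (![1, 5, 6, 6, 6] i)) hr rfl rfl rfl, hl, ?_, hd', ?_, ?_⟩
      · refine Steps.jumpEq_of_ne hc0 ?_ ?_
        -- Comparing registers decides equality of trees, since addresses are injective on `U`.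
        · intro he
          exact h (hR.stored.1 hw hu (Option.some.inj he))
        refine Steps.load hc1 rfl hcell ?_
        rw [update_regs_five, h1]
        refine Steps.alloc hc2 ?_
        rw [update_regs_one]
        refine Steps.load hc3 rfl ((List.prefix_append _ _).getElem?_of_eq_some hcell) ?_
        rw [update_regs_four, h0]
        exact Steps.refl _
      · rwa [onPath_cat hd'] at huw
      · simp [depth]
      · intro j hj
        rw [after_cat (hj.trans hd'), stackStr_cons, List.append_assoc]
        rfl

/-- Reporting the first character of a tree and saving the rest for later. -/
theorem report {x : SLTree α} (hR : Ready U adr heap r₁ S) (hx : x ∈ U) :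
    ∃ r₁' r₅' heap' S',
      Steps 6 (config 25 r₀ r₁ (some (adr x)) r₃ r₄ r₅ heap o)
        (config 2 r₀ r₁' (some (adr x)) r₃ r₄ r₅' heap' (o ++ [x.first])) ∧
      Ready U adr heap' r₁' S' ∧ x.str ++ stackStr S = x.first :: stackStr S' := by
  obtain ⟨cell, hcell, hdata, hleaf, hs⟩ := hR.stored.2 _ hx
  cases hxc : x with
  | leaf c =>
    rw [← hxc]
    refine ⟨r₁, none, heap, S, ?_, hR, by simp [hxc, str, first]⟩
    refine Steps.output rfl rfl hcell hdata ?_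
    refine Steps.load rfl rfl hcell ?_
    rw [update_regs_five, hleaf (by simp [hxc, depth])]
    exact Steps.jumpNull_of_eq rfl rfl (Steps.refl _)
  | cat l r =>
    rw [← hxc]
    have hpos : 0 < x.depth := by simp [hxc, depth]
    obtain ⟨h0, -, h2, -⟩ := hs l r hxc
    have hda := depth_anchor hpos
    have hspec := anchorDepth_spec hpos
    have hc := isCarrier_carrier hx hpos
    have hg : (Frame.list x.anchor x 0).Good U := by
      refine ⟨anchor_mem hR.closed hx, hx, ⟨_, hda⟩, hc, ?_, ?_, ?_, ?_⟩
      · rw [hda]; exact Nat.pow_pos (by norm_num)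
      · rw [hda]; rfl
      · omega
      · omega
    refine ⟨_, some (adr x.anchor), _, .list x.anchor x 0 :: S, ?_,
      hR.pushList (f := fun i => regs r₀ r₁ (some (adr x)) r₃ r₄
          (some (adr x.anchor)) (![1, 5, 5, 2, 6] i)) hg rfl rfl ?_ rfl, ?_⟩
    · refine Steps.output rfl rfl hcell hdata ?_
      refine Steps.load rfl rfl hcell ?_
      rw [update_regs_five, h0]
      refine Steps.jumpNull_of_ne rfl (Option.some_ne_none _) ?_
      refine Steps.load rfl rfl hcell ?_
      rw [update_regs_five, h2]
      refine Steps.alloc rfl ?_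
      rw [update_regs_one]
      exact Steps.jumpNull_of_eq rfl rfl (Steps.refl _)
    -- The anchor is the first node of its own list, so one register fills both fields.
    · rw [listNode_zero hc]; rfl
    · rw [stackStr_cons, first_cons_after]; rfl

/-- The part of the main loop that advances in the list of the topmost frame. -/
theorem advance {u w : SLTree α} {j : ℕ} (hR : Ready U adr heap r₁ S)
    (hg : (Frame.list u w j).Good U) :
    ∃ r₀' r₁' r₃' r₄' r₅' heap' S' x,
      Steps 17 (config 8 r₀ r₁ (some (adr u)) (some (adr (listNode U u j))) (some (adr w)) r₅
          heap o)
        (config 25 r₀' r₁' (some (adr x)) r₃' r₄' r₅' heap' o) ∧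
      Ready U adr heap' r₁' S' ∧ x ∈ U ∧ w.after j ++ stackStr S = x.str ++ stackStr S' := by
  obtain ⟨hu, hw, ⟨e, he⟩, hcar, hj, huw, hd, hbound⟩ := hg
  obtain ⟨r₁, r₅, heap, w₁, S, s1, hR, hw, huw, hd, hb1, e1⟩ :=
    descend (r₀ := r₀) (r₃ := some (adr (listNode U u j))) (r₅ := r₅) (o := o) (pc := 8)
      rfl rfl rfl rfl hR hu hw huw hd
  obtain ⟨r₁, r₅, heap, w₂, S, s2, hR, hw, huw, hd, hb2, e2⟩ :=
    descend (r₀ := r₀) (r₃ := some (adr (listNode U u j))) (r₅ := r₅) (o := o) (pc := 12)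
      rfl rfl rfl rfl hR hu hw huw hd
  obtain ⟨r₁, r₅, heap, w₃, S, s3, hR, hw, huw, hd, hb3, e3⟩ :=
    descend (r₀ := r₀) (r₃ := some (adr (listNode U u j))) (r₅ := r₅) (o := o) (pc := 16)
      rfl rfl rfl rfl hR hu hw huw hd
  rw [e1 j hj.le, e2 j hj.le, e3 j hj.le]
  have hln := listNode_mem (j := j) hR.closed hu
  have hit := item_listNode he hcar hj
  have hitem : u.onPath (j + 1) ∈ U := hR.closed.onPath_mem hu _
  obtain ⟨l, r, hlr, haf⟩ := after_eq (hj.trans_le hd)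
  -- The next right child on the path of `w` hangs off a node that is also on the path of `u`, and
  -- this node is the current list item.
  have hpath : u.onPath (j + 1) = cat l r := by
    rw [← huw, onPath_onPath _ hj, hlr]
  have hr : r ∈ U := (hR.closed l r (hpath ▸ hitem)).2
  obtain ⟨cell, hcell, -, -, hs⟩ := hR.stored.2 _ hln
  obtain ⟨lp, rp, hlp⟩ : ∃ lp rp, listNode U u j = cat lp rp := by
    cases hl : listNode U u j with
    | leaf c =>
      have := depth_listNode hcar hj
      rw [hl] at this
      simp only [depth] at this
      omega
    | cat lp rp => exact ⟨_, _, rfl⟩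
  obtain ⟨-, -, -, hp3, hp4⟩ := hs _ _ hlp
  rw [hit] at hp4
  rw [next_listNode he hcar hj] at hp3
  by_cases hlast : j + 1 = u.depth
  · have hwu : w₃.depth = u.depth := by omega
    have hiu : u.onPath (j + 1) = u := by rw [hlast, onPath_eq_self le_rfl]
    refine ⟨some (adr u), r₁, some (adr (listNode U u j)), some (adr w₃), r₅, heap, S, r, ?_,
      hR, hr, ?_⟩
    · refine ((s1.trans s2).trans s3).trans (n := 5) ?_
      refine (?_ : Steps 3 _ _).mono (by norm_num)
      refine Steps.load rfl rfl hcell ?_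
      rw [update_regs_zero, hp4, hiu]
      refine Steps.jumpEq_of_eq rfl rfl ?_
      obtain ⟨cell', hcell', -, -, hs'⟩ := hR.stored.2 _ hu
      refine Steps.load rfl rfl hcell' ?_
      rw [update_regs_two, (hs' l r (hiu ▸ hpath)).2.1]
      exact Steps.refl _
    · rw [haf, after_eq_nil (by omega), List.append_nil]
  · have hg' : (Frame.list u w₃ (j + 1)).Good U :=
      ⟨hu, hw, ⟨e, he⟩, hcar, by omega, huw, hd, by omega⟩
    have hne : u.onPath (j + 1) ≠ u := by
      intro h
      have := depth_onPath (x := u) (d := j + 1) hj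
      rw [h] at this
      omega
    refine ⟨some (adr (u.onPath (j + 1))), _, some (adr (listNode U u (j + 1))), some (adr w₃), r₅,
      _, .list u w₃ (j + 1) :: S, r, ?_,
      hR.pushList (f := fun i => regs (some (adr (u.onPath (j + 1)))) r₁ (some (adr u))
        (some (adr (listNode U u (j + 1)))) (some (adr w₃)) r₅ (![1, 2, 3, 4, 6] i)) hg' rfl rfl
        rfl rfl, hr, ?_⟩
    · refine ((s1.trans s2).trans s3).trans (n := 5) ?_
      refine Steps.load rfl rfl hcell ?_
      rw [update_regs_zero, hp4]
      refine Steps.jumpEq_of_ne rfl ?_ ?_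
      · intro h
        exact hne (hR.stored.1 hitem hu (Option.some.inj h))
      refine Steps.load rfl rfl hcell ?_
      rw [update_regs_three, hp3]
      refine Steps.alloc rfl ?_
      rw [update_regs_one]
      obtain ⟨cell', hcell', -, -, hs'⟩ := hR.stored.2 _ hitem
      refine Steps.load rfl rfl ((List.prefix_append _ _).getElem?_of_eq_some hcell') ?_
      rw [update_regs_two, (hs' l r hpath).2.1]
      exact Steps.refl _
    · rw [haf, stackStr_cons, List.append_assoc]; rfl

/-- Each round of the main loop reports one character. -/
theorem loop {f : Frame α} (hR : Ready U adr heap r₁ (f :: S)) :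
    ∃ r₀' r₁' r₂' r₃' r₄' r₅' heap' S' c,
      Steps 29 (config 2 r₀ r₁ r₂ r₃ r₄ r₅ heap o)
        (config 2 r₀' r₁' r₂' r₃' r₄' r₅' heap' (o ++ [c])) ∧
      Ready U adr heap' r₁' S' ∧ stackStr (f :: S) = c :: stackStr S' := by
  obtain ⟨hcl, hst, hS, hgood⟩ := hR
  have hgS : ∀ g ∈ S, g.Good U := fun g hg => hgood g (List.mem_cons_of_mem _ hg)
  have hgf : f.Good U := hgood f List.mem_cons_self
  cases hS with
  | @tree p cell x _ h h1 h2 hS =>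
    obtain ⟨r₁', r₅', heap', S', hsteps, hR', hv⟩ := report (r₀ := r₀) (r₃ := none)
      (r₄ := cell.ptr 3) (r₅ := r₅) (o := o) ⟨hcl, hst, hS, hgS⟩ (show x ∈ U from hgf)
    refine ⟨r₀, r₁', some (adr x), none, cell.ptr 3, r₅', heap', S', x.first, ?_, hR', hv⟩
    -- Popping a frame takes 6 steps and `report` another 6; a list frame needs the 17 steps of
    -- `advance` in between, hence 29.
    refine (?_ : Steps 12 _ _).mono (by norm_num)
    refine Steps.jumpNull_of_ne rfl (Option.some_ne_none _) ?_
    refine Steps.load rfl rfl h ?_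
    rw [update_regs_two, h1]
    refine Steps.load rfl rfl h ?_
    rw [update_regs_three, h2]
    refine Steps.load rfl rfl h ?_
    rw [update_regs_four]
    refine Steps.load rfl rfl h ?_
    rw [update_regs_one]
    exact Steps.jumpNull_of_eq rfl rfl hsteps
  | @list p cell u w j _ h h1 h2 h3 hS =>
    obtain ⟨r₀', r₁', r₃', r₄', r₅', heap', S', x, hsteps, hR', hx, hv⟩ := advance (r₀ := r₀)
      (r₅ := r₅) (o := o) ⟨hcl, hst, hS, hgS⟩ hgf
    obtain ⟨r₁'', r₅'', heap'', S'', hsteps', hR'', hv'⟩ := report (r₀ := r₀') (r₃ := r₃')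
      (r₄ := r₄') (r₅ := r₅') (o := o) hR' hx
    refine ⟨r₀', r₁'', some (adr x), r₃', r₄', r₅'', heap'', S'', x.first, ?_, hR'', hv.trans hv'⟩
    refine Steps.jumpNull_of_ne rfl (Option.some_ne_none _) ?_
    refine Steps.load rfl rfl h ?_
    rw [update_regs_two, h1]
    refine Steps.load rfl rfl h ?_
    rw [update_regs_three, h2]
    refine Steps.load rfl rfl h ?_
    rw [update_regs_four, h3]
    refine Steps.load rfl rfl h ?_
    rw [update_regs_one]
    exact Steps.jumpNull_of_ne rfl (Option.some_ne_none _) (hsteps.trans hsteps')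

theorem loop_iterate (hR : Ready U adr heap r₁ S) {ℓ : ℕ} (hℓ : ℓ ≤ (stackStr S).length) :
    ∃ r₀' r₁' r₂' r₃' r₄' r₅' heap' S',
      Steps (29 * ℓ) (config 2 r₀ r₁ r₂ r₃ r₄ r₅ heap o)
        (config 2 r₀' r₁' r₂' r₃' r₄' r₅' heap' (o ++ (stackStr S).take ℓ)) ∧
      Ready U adr heap' r₁' S' ∧ stackStr S' = (stackStr S).drop ℓ := by
  induction ℓ generalizing r₀ r₁ r₂ r₃ r₄ r₅ heap o S with
  | zero => exact ⟨r₀, r₁, r₂, r₃, r₄, r₅, heap, S, by simpa using Steps.refl _, hR, rfl⟩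
  | succ ℓ ih =>
    cases S with
    | nil => simp [stackStr] at hℓ
    | cons f S =>
      obtain ⟨r₀', r₁', r₂', r₃', r₄', r₅', heap', S', c, h1, h2, h3⟩ := loop (r₀ := r₀) (r₂ := r₂)
        (r₃ := r₃) (r₄ := r₄) (r₅ := r₅) (o := o) hR
      rw [h3] at hℓ ⊢
      obtain ⟨a₀, a₁, a₂, a₃, a₄, a₅, heap'', S'', h4, h5, h6⟩ := ih (r₀ := r₀') (r₂ := r₂')
        (r₃ := r₃') (r₄ := r₄') (r₅ := r₅') (o := o ++ [c]) h2 (by simpa using hℓ)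
      refine ⟨a₀, a₁, a₂, a₃, a₄, a₅, heap'', S'', ?_, h5, by simpa using h6⟩
      rw [List.take_succ_cons, List.append_cons, Nat.mul_succ, Nat.add_comm]
      exact h1.trans h4

/-- No frame on the stack is ever empty, so the program halts right after the last character. -/
theorem Ready.eq_nil {p : Option ℕ} (hR : Ready U adr heap p S) (h : stackStr S = []) :
    p = none := by
  cases S with
  | nil => cases hR.stack; rfl
  | cons f S =>
    rw [stackStr_cons, List.append_eq_nil_iff] at h
    exact absurd h.1 (hR.good f List.mem_cons_self).str_ne_nil

theorem store_notMem_spineProgram (x : Fin (spineProgram.regs + 1)) (i : Fin spineProgram.fields)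
    (v : Fin (spineProgram.regs + 1)) : Instr.store x i v ∉ spineProgram.code := by
  simp

theorem extractsOnline_spineProgram (hU : Closed U) (hst : Stored U adr heap) {entry : ℕ}
    {x : SLTree α} (hx : x ∈ U) {cell : Cell 5 α} (hcell : heap[entry]? = some cell)
    (hptr : cell.ptr 2 = some (adr x)) :
    spineProgram.ExtractsOnline 32 heap entry x.str := by
  have hinit : spineProgram.init heap entry = config 0 (some entry) none none none none none
      heap [] := by
    unfold PointerProgram.init config
    congr 1
    funext i; fin_cases i <;> rfl
  have hR : Ready U adr _ _ [.tree x] := Ready.pushTree (heap := heap) (p := none)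
    (f := fun i => regs (some (adr x)) none none none none none (![1, 0, 6, 6, 6] i))
    ⟨hU, hst, .nil, by simp⟩ hx rfl rfl rfl
  have hstart : Steps 2 (spineProgram.init heap entry) (config 2 (some (adr x)) (some heap.length)
      none none none none (heap ++ [⟨fun i => regs (some (adr x)) none none none none none
        (![1, 0, 6, 6, 6] i), none⟩]) []) := by
    rw [hinit]
    refine Steps.load rfl rfl hcell ?_
    rw [update_regs_zero, hptr]
    refine Steps.alloc rfl ?_
    rw [update_regs_one]
    exact Steps.refl _
  have hstr : stackStr [Frame.tree x] = x.str := by simp [stackStr, Frame.str]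
  -- A nonempty string pays for the two initial steps and the final jump: `29 * ℓ + 3 ≤ 32 * ℓ` for
  -- `ℓ ≥ 1`.
  have hpos : 0 < x.str.length := List.length_pos_iff.2 x.str_ne_nil
  refine extractsOnline_of_forall_prefix store_notMem_spineProgram (fun ℓ hℓ => ?_) ?_
  · rcases Nat.eq_zero_or_pos ℓ with rfl | hℓ0
    · exact ⟨0, le_rfl, rfl⟩
    · obtain ⟨a₀, a₁, a₂, a₃, a₄, a₅, heap', S', h1, -, -⟩ := loop_iterate
        (r₀ := some (adr x)) (r₂ := none) (r₃ := none) (r₄ := none) (r₅ := none) (o := []) hR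
        (ℓ := ℓ) (by rwa [hstr])
      obtain ⟨t, ht, h⟩ := hstart.trans h1
      refine ⟨t, by omega, ?_⟩
      rw [PointerProgram.run, h, hstr]
      rfl
  · obtain ⟨a₀, a₁, a₂, a₃, a₄, a₅, heap', S', h1, h2, h3⟩ := loop_iterate
      (r₀ := some (adr x)) (r₂ := none) (r₃ := none) (r₄ := none) (r₅ := none) (o := []) hR
      le_rfl
    rw [hstr] at h1 h3
    obtain rfl := h2.eq_nil (by simpa using h3)
    have h4 : Steps 1 (config 2 a₀ none a₂ a₃ a₄ a₅ heap' ([] ++ x.str.take x.str.length))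
        (config 31 a₀ none a₂ a₃ a₄ a₅ heap' ([] ++ x.str.take x.str.length)) :=
      Steps.jumpNull_of_eq rfl rfl (Steps.refl _)
    obtain ⟨t, ht, h⟩ := (hstart.trans h1).trans h4
    refine ⟨t, by omega, ?_⟩
    rw [PointerProgram.run, h]
    exact ⟨by simp [config], rfl⟩

end SLTree

/-! ## The data structure -/

open Classical in
/-- The address of an element that satisfies `R`, null if there is none. -/
noncomputable def pointerTo {β : Type*} (adr : β → ℕ) (R : β → Prop) : Option ℕ :=
  if h : ∃ y, R y then some (adr h.choose) else none

theorem pointerTo_eq_some {β : Type*} {adr : β → ℕ} {R : β → Prop} {y : β} (hy : R y)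
    (hR : ∀ z, R z → z = y) : pointerTo adr R = some (adr y) := by
  unfold pointerTo
  have h : ∃ y, R y := ⟨y, hy⟩
  rw [dif_pos h, hR _ h.choose_spec]

theorem pointerTo_eq_none {β : Type*} {adr : β → ℕ} {R : β → Prop} (h : ¬ ∃ y, R y) :
    pointerTo adr R = none :=
  dif_neg h

theorem exists_of_pointerTo_eq_some {β : Type*} {adr : β → ℕ} {R : β → Prop} {a : ℕ}
    (h : pointerTo adr R = some a) : ∃ y, R y ∧ adr y = a := by
  unfold pointerTo at h
  split_ifs at h with hex
  exact ⟨_, hex.choose_spec, Option.some.inj h⟩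

/-- The memory node for a straight-line program. -/
noncomputable def SLTree.cell {α : Type*} (U : Set (SLTree α)) (adr : SLTree α → ℕ) :
    SLTree α → Cell 5 α
  | leaf x => ⟨fun _ => none, some x⟩
  | cat l r => ⟨![some (adr l), some (adr r), some (adr (cat l r).anchor),
      some (adr ((cat l r).next U)), some (adr (cat l r).item)], some (cat l r).first⟩

theorem SLTree.cellSpec_cell {α : Type*} (U : Set (SLTree α)) (adr : SLTree α → ℕ)
    (x : SLTree α) : CellSpec U adr x (x.cell U adr) := by
  cases x with
  | leaf x => exact ⟨rfl, fun _ => rfl, by simp⟩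
  | cat l r =>
    refine ⟨rfl, by simp [depth], ?_⟩
    rintro _ _ ⟨⟩
    exact ⟨rfl, rfl, rfl, rfl, rfl⟩

theorem SLTree.exists_of_cell_ptr {α : Type*} {U : Set (SLTree α)} (hU : Closed U)
    {adr : SLTree α → ℕ} {x : SLTree α} (hx : x ∈ U) {i : Fin 5} {a : ℕ}
    (h : (x.cell U adr).ptr i = some a) : ∃ y ∈ U, adr y = a := by
  cases x with
  | leaf x => simp [cell] at h
  | cat l r =>
    obtain ⟨hl, hr⟩ := hU _ _ hx
    fin_cases i
    · exact ⟨_, hl, Option.some.inj h⟩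
    · exact ⟨_, hr, Option.some.inj h⟩
    · exact ⟨_, anchor_mem hU hx, Option.some.inj h⟩
    · exact ⟨_, next_mem hU hx, Option.some.inj h⟩
    · exact ⟨_, item_mem hU hx, Option.some.inj h⟩

namespace TopTree

variable {α : Type*} (T : LabeledTree α) (τ : TopTree)

/-- The nodes of the vertical top DAG as a list. -/
noncomputable def dagList : List (LabelTree α) := (τ.dagNodes_finite T).toFinset.toList

/-- The straight-line programs of the nodes of the vertical top DAG. -/
def slNodes : Set (SLTree α) := LabelTree.toSL '' τ.dagNodes T

/-- The straight-line programs of the nodes of the vertical top DAG as a list. -/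
noncomputable def slList : List (SLTree α) :=
  ((τ.dagNodes_finite T).image LabelTree.toSL).toFinset.toList

open Classical in
/-- The address of a node of the vertical top DAG. -/
noncomputable def dagAddr (X : LabelTree α) : ℕ := (τ.dagList T).idxOf X

open Classical in
/-- The address of a straight-line program. -/
noncomputable def slAddr (x : SLTree α) : ℕ := (τ.dagList T).length + (τ.slList T).idxOf x

/-- The memory node for a node of the vertical top DAG. -/
noncomputable def dagCell (X : LabelTree α) : Cell 5 α where
  ptr := ![pointerTo (τ.dagAddr T) (τ.DagLeft T X), pointerTo (τ.dagAddr T) (τ.DagRight T X),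
    some (τ.slAddr T X.toSL), none, none]
  data := match X with
    | .leaf x => some x
    | .node _ _ _ => none

/-- The data structure: the vertical top DAG and the straight-line programs of its nodes. -/
noncomputable def memory : List (Cell 5 α) :=
  (τ.dagList T).map (τ.dagCell T) ++ (τ.slList T).map (SLTree.cell (τ.slNodes T) (τ.slAddr T))

variable {T τ}

theorem mem_dagList {X : LabelTree α} : X ∈ τ.dagList T ↔ X ∈ τ.dagNodes T := by
  simp [dagList]

theorem mem_slList {x : SLTree α} : x ∈ τ.slList T ↔ x ∈ τ.slNodes T := by
  simp [slList, slNodes]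

theorem dagAddr_lt {X : LabelTree α} (hX : X ∈ τ.dagNodes T) :
    τ.dagAddr T X < (τ.dagList T).length := by
  classical exact List.idxOf_lt_length_of_mem (mem_dagList.2 hX)

theorem memory_dagAddr {X : LabelTree α} (hX : X ∈ τ.dagNodes T) :
    (τ.memory T)[τ.dagAddr T X]? = some (τ.dagCell T X) := by
  classical
  rw [memory, List.getElem?_append_left (by simpa using dagAddr_lt hX), List.getElem?_map, dagAddr,
    List.getElem?_idxOf (mem_dagList.2 hX)]
  rfl

theorem memory_slAddr {x : SLTree α} (hx : x ∈ τ.slNodes T) :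
    (τ.memory T)[τ.slAddr T x]? = some (x.cell (τ.slNodes T) (τ.slAddr T)) := by
  classical
  rw [memory, List.getElem?_append_right (by simp [slAddr]), List.getElem?_map, slAddr,
    List.length_map, Nat.add_sub_cancel_left, List.getElem?_idxOf (mem_slList.2 hx)]
  rfl

theorem dagAddr_lt_memory {X : LabelTree α} (hX : X ∈ τ.dagNodes T) :
    τ.dagAddr T X < (τ.memory T).length :=
  (List.getElem?_eq_some_iff.1 (memory_dagAddr hX)).1

theorem slAddr_lt_memory {x : SLTree α} (hx : x ∈ τ.slNodes T) :
    τ.slAddr T x < (τ.memory T).length :=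
  (List.getElem?_eq_some_iff.1 (memory_slAddr hx)).1

/-- The programs are the image of the DAG nodes under `toSL`, so there are no more of them than DAG
nodes. -/
theorem length_memory_le : (τ.memory T).length ≤ 2 * τ.dagSize T := by
  have h1 : (τ.dagList T).length = τ.dagSize T := by
    rw [dagList, Finset.length_toList, dagSize, Set.ncard_eq_toFinset_card _ (τ.dagNodes_finite T)]
  have h2 : (τ.slList T).length ≤ τ.dagSize T := by
    rw [slList, Finset.length_toList,
      ← Set.ncard_eq_toFinset_card _ ((τ.dagNodes_finite T).image LabelTree.toSL)]
    exact Set.ncard_image_le (τ.dagNodes_finite T)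
  rw [memory, List.length_append, List.length_map, List.length_map]
  omega

theorem closed_slNodes (h : τ.Valid T) : SLTree.Closed (τ.slNodes T) :=
  fun _ _ hx => children_mem_toSL_image h hx

theorem closedHeap_memory (h : τ.Valid T) : PointerProgram.ClosedHeap (τ.memory T) := by
  intro cell hcell i a ha
  rcases List.mem_append.1 hcell with hc | hc
  · obtain ⟨X, hX, rfl⟩ := List.mem_map.1 hc
    fin_cases i
    · obtain ⟨Y, ⟨C, -, D, hD, -, -, rfl⟩, rfl⟩ := exists_of_pointerTo_eq_some ha
      exact dagAddr_lt_memory ⟨D, hD, rfl⟩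
    · obtain ⟨Y, ⟨C, -, D, hD, -, -, rfl⟩, rfl⟩ := exists_of_pointerTo_eq_some ha
      exact dagAddr_lt_memory ⟨D, hD, rfl⟩
    · obtain rfl := Option.some.inj ha
      exact slAddr_lt_memory ⟨X, mem_dagList.1 hX, rfl⟩
    · cases ha
    · cases ha
  · obtain ⟨x, hx, rfl⟩ := List.mem_map.1 hc
    obtain ⟨y, hy, rfl⟩ := SLTree.exists_of_cell_ptr (closed_slNodes h) (mem_slList.1 hx) ha
    exact slAddr_lt_memory hy

theorem stored_memory : SLTree.Stored (τ.slNodes T) (τ.slAddr T) (τ.memory T) := by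
  classical
  refine ⟨fun x hx y _ hxy => ?_, fun x hx =>
    ⟨_, memory_slAddr hx, SLTree.cellSpec_cell _ _ _⟩⟩
  exact (List.idxOf_inj (mem_slList.2 hx)).1 (Nat.add_left_cancel hxy)

theorem containsDag_memory (h : τ.Valid T) :
    PointerProgram.ContainsDag (τ.memory T) 0 1 T τ (τ.dagAddr T) := by
  classical
  refine ⟨fun X hX Y _ hXY => (List.idxOf_inj (mem_dagList.2 hX)).1 hXY, fun X hX =>
    ⟨_, memory_dagAddr hX, fun Y hY => ?_, fun hn => pointerTo_eq_none hn, fun Y hY => ?_,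
      fun hn => pointerTo_eq_none hn, ?_⟩⟩
  · exact pointerTo_eq_some hY fun Z hZ => DagLeft.unique h hZ hY
  · exact pointerTo_eq_some hY fun Z hZ => DagRight.unique h hZ hY
  · rintro x rfl
    rfl

end TopTree

theorem mainTheorem7 :
    ∃ (P : PointerProgram) (left right : Fin P.fields) (c : ℕ),
      ∀ (α : Type*) (T : LabeledTree α) (τ : TopTree), τ.IsTopTreeOf T →
        ∃ (H : List (Cell P.fields α)) (addr : LabelTree α → ℕ),
          PointerProgram.ClosedHeap H ∧
          H.length ≤ c * τ.dagSize T ∧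
          PointerProgram.ContainsDag H left right T τ addr ∧
          ∀ C ∈ τ.subtrees, C.IsVertical →
            P.ExtractsOnline c H (addr (C.erase T)) (C.spine T) := by
  refine ⟨spineProgram, (0 : Fin 5), (1 : Fin 5), 32, fun α T τ hτ => ?_⟩
  have h := hτ.1
  refine ⟨τ.memory T, τ.dagAddr T, TopTree.closedHeap_memory h,
    TopTree.length_memory_le.trans (Nat.mul_le_mul_right _ (by norm_num)),
    TopTree.containsDag_memory h, fun C hC hv => ?_⟩
  rw [TopTree.spine_eq_str (h.of_mem_subtrees hC) hv]
  have hX : C.erase T ∈ τ.dagNodes T := ⟨C, ⟨hC, Or.inl hv⟩, rfl⟩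
  exact SLTree.extractsOnline_spineProgram (TopTree.closed_slNodes h) TopTree.stored_memory
    ⟨_, hX, rfl⟩ (TopTree.memory_dagAddr hX) rfl
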